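/- Let $\mathfrak S_n$ be the set of permutations of $[n]=\{1,\dots,n\}$. A permutation $\sigma\in\mathfrak S_n$ contains a permutation $\pi\in\mathfrak S_m$ if some subsequence $\sigma_{i_1}\cdots\sigma_{i_m}$ with $i_1<\cdots<i_m$ has the same relative order as $\pi$; for $\Pi\subseteq\mathfrak S_m$ let $\mathfrak S_n(\Pi)$ be the set of $\sigma\in\mathfrak S_n$ that contain no element of $\Pi$. Put $\operatorname{Des}\sigma=\{i\in[n-1] : \sigma_i>\sigma_{i+1}\}$. For $S\subseteq[n-1]$ the fundamental quasisymmetric function of degree $n$ is $$F_S=\sum x_{i_1}x_{i_2}\cdots x_{i_n}\in\mathbb R[[x_1,x_2,\dots]],$$ summed over all $i_1\le i_2\le\cdots\le i_n$ with $i_j<i_{j+1}$ whenever $j\in S$. Set $$Q_n(\Pi)=\sum_{\sigma\in\mathfrak S_n(\Pi)}F_{\operatorname{Des}\sigma}.$$ For $a\in[N]$ let $(1,\dots,\widehat a,\dots,N)\mathbin{\widetilde{\sqcup\!\sqcup}}a$ denote the set of all permutations in $\mathfrak S_N$ whose one-line notation is a shuffle of the word $1\,2\cdots N$ with the letter $a$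 deleted and the one-letter word $a$, except for the identity permutation. For $k\ge1$ put $$\Pi_{k,2}=(1,\dots,k+1,\widehat{k+2})\mathbin{\widetilde{\sqcup\!\sqcup}}(k+2),\qquad \Pi_{k,1}=(1,\dots,k,\widehat{k+1},k+2)\mathbin{\widetilde{\sqcup\!\sqcup}}(k+1),$$ both subsets of $\mathfrak S_{k+2}$. Let $s_\lambda$ be the Schur function of a partition $\lambda$ (the generating function $\sum_T\prod_{c\in\lambda}x_{T(c)}$ of the semistandard Young tableaux $T$ of shape $\lambda$), let $f^\lambda$ be the number of standard Young tableaux of shape $\lambda$, and let $H_{n,k+1}$ be the set of partitions $\lambda$ of $n$ whose Young diagram does not contain the cell in row $2$ and column $k+1$, that is, with $\lambda_2\le k$. For $\lambda\in H_{n,k+1}$ let $\overline\lambda$ be the partition obtained from $\lambda$ by replacing its first part $\lambda_1$ by $\min\{\lambda_1,k\}$. **Theorem.** For all $k\ge1$ and $n\ge0$, $$Q_n(\Pi_{k,2})=Q_n(\Pi_{k,1})=\sum_{\lambda\in H_{n,k+1}}f^{\overline\lambda}\,s_\lambda .$$ -/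

import Mathlib

namespace PatternQSym

/-! ### Permutations and patterns

The symmetric group `𝔖ₙ` is `Equiv.Perm (Fin n)`; positions and values are `0, …, n - 1`
instead of `1, …, n`. -/

/-- `σ` contains the pattern `π`: some subsequence of `σ` (in the positions `e 0 < e 1 < ⋯`)
has the same relative order as `π`. -/
def Contains {n m : ℕ} (σ : Equiv.Perm (Fin n)) (π : Equiv.Perm (Fin m)) : Prop :=
  ∃ e : Fin m → Fin n, StrictMono e ∧ ∀ a b : Fin m, σ (e a) < σ (e b) ↔ π a < π b

open Classical in
/-- `𝔖ₙ(Π)`: the permutations in `𝔖ₙ` that contain no element of `Π`. -/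
noncomputable def avoiders (n : ℕ) {m : ℕ} (P : Set (Equiv.Perm (Fin m))) :
    Finset (Equiv.Perm (Fin n)) :=
  Finset.univ.filter fun σ => ∀ π ∈ P, ¬ Contains σ π

/-- The descent set of `σ`. The descent between the positions `i` and `i + 1` (counted from `0`)
is recorded as `i`. -/
def descents {n : ℕ} (σ : Equiv.Perm (Fin n)) : Set ℕ :=
  {i | ∃ h : i + 1 < n, σ ⟨i + 1, h⟩ < σ ⟨i, Nat.lt_of_succ_lt h⟩}

/-- `IsShuffle u v w`: the word `w` is a shuffle (an interleaving) of the words `u` and `v`. -/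
inductive IsShuffle {α : Type*} : List α → List α → List α → Prop
  | nil : IsShuffle [] [] []
  | left {u v w : List α} (x : α) : IsShuffle u v w → IsShuffle (x :: u) v (x :: w)
  | right {u v w : List α} (x : α) : IsShuffle u v w → IsShuffle u (x :: v) (x :: w)

/-- The partial shuffle of the increasing word on all letters but `a` with the letter `a`: all
shuffles of these two words, except for the identity permutation. -/
def partialShuffle {N : ℕ} (a : Fin N) : Set (Equiv.Perm (Fin N)) :=
  {π | IsShuffle ((List.finRange N).erase a) [a] (List.ofFn π)} \ {1}

/-- `Π_{k,2}`: the partial shuffle of `1, …, k + 1` with `k + 2`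
(the largest letter, which is `k + 1` when counted from `0`). -/
def patternSetTwo (k : ℕ) : Set (Equiv.Perm (Fin (k + 2))) :=
  partialShuffle ⟨k + 1, by omega⟩

/-- `Π_{k,1}`: the partial shuffle of `1, …, k, k + 2` with `k + 1`
(the second largest letter, which is `k` when counted from `0`). -/
def patternSetOne (k : ℕ) : Set (Equiv.Perm (Fin (k + 2))) :=
  partialShuffle ⟨k, by omega⟩

/-! ### Power series in the variables `x₀, x₁, x₂, …` -/

/-- The formal sum `∑ₐ x ^ (w a)` of a family of monomials in which every monomial occurs finitely
often: the coefficient of `x ^ d` is the number of the `a` with `w a = d`. -/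
noncomputable def monomialSum {ι : Type*} (w : ι → ℕ →₀ ℕ) : MvPowerSeries ℕ ℝ :=
  fun d => (Nat.card {a : ι // w a = d} : ℝ)

/-- The index sequences `i₀ ≤ i₁ ≤ ⋯ ≤ iₙ₋₁` with `iⱼ < iⱼ₊₁` for all `j ∈ S`. -/
abbrev FundamentalIndex (n : ℕ) (S : Set ℕ) : Type :=
  {i : Fin n → ℕ // Monotone i ∧
    ∀ (j : ℕ) (h : j + 1 < n), j ∈ S → i ⟨j, Nat.lt_of_succ_lt h⟩ < i ⟨j + 1, h⟩}

/-- The fundamental quasisymmetric function `F_S` of degree `n`: the sum of the monomials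
`x_{i₀} x_{i₁} ⋯ x_{iₙ₋₁}` over all index sequences as above. -/
noncomputable def fundamental (n : ℕ) (S : Set ℕ) : MvPowerSeries ℕ ℝ :=
  monomialSum fun i : FundamentalIndex n S => ∑ j, Finsupp.single (i.1 j) 1

/-- `Qₙ(Π)`: the sum of `F_{Des σ}` over all `σ ∈ 𝔖ₙ(Π)`. -/
noncomputable def Q (n : ℕ) {m : ℕ} (P : Set (Equiv.Perm (Fin m))) : MvPowerSeries ℕ ℝ :=
  ∑ σ ∈ avoiders n P, fundamental n (descents σ)

/-- The Schur function `s_μ`: the sum over all semistandard tableaux `T` of shape `μ` of the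
monomials `∏ x_{T c}`, where `c` runs through the cells of `μ`. -/
noncomputable def schur (μ : YoungDiagram) : MvPowerSeries ℕ ℝ :=
  monomialSum fun T : SemistandardYoungTableau μ =>
    ∑ c ∈ μ.cells, Finsupp.single (T c.1 c.2) 1

/-! ### Partitions and standard tableaux

A partition of `n` is a Young diagram with `n` cells; the cell in row `r` and column `c`
(counted from `1`) is `(r - 1, c - 1)`. -/

/-- Standard Young tableaux of shape `μ`: bijective fillings of the cells whose rows and columns
increase (the entries are `0, …, n - 1` instead of `1, …, n`). -/
abbrev SYT (μ : YoungDiagram) : Type :=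
  {T : μ.cells ≃ Fin μ.card //
    (∀ c d : μ.cells, c.1.1 = d.1.1 → c.1.2 < d.1.2 → T c < T d) ∧
    (∀ c d : μ.cells, c.1.2 = d.1.2 → c.1.1 < d.1.1 → T c < T d)}

/-- `f^μ`: the number of standard Young tableaux of shape `μ`. -/
noncomputable def numSYT (μ : YoungDiagram) : ℕ := Nat.card (SYT μ)

theorem finite_card_eq (n : ℕ) : {μ : YoungDiagram | μ.card = n}.Finite := by
  refine Set.Finite.of_finite_image (f := YoungDiagram.cells)
    (((Finset.range n ×ˢ Finset.range n).powerset.finite_toSet).subset ?_)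
    (fun μ _ ν _ h => YoungDiagram.ext h)
  rintro _ ⟨μ, rfl, rfl⟩
  simp only [Finset.coe_powerset, Set.mem_preimage, Set.mem_powerset_iff, Finset.coe_subset]
  rintro ⟨i, j⟩ h
  rw [YoungDiagram.mem_cells] at h
  have h1 := YoungDiagram.mem_iff_lt_rowLen.1 h
  have h2 := YoungDiagram.mem_iff_lt_colLen.1 h
  rw [YoungDiagram.rowLen_eq_card] at h1
  rw [YoungDiagram.colLen_eq_card] at h2
  have h3 : (μ.row i).card ≤ μ.card := Finset.card_le_card (Finset.filter_subset _ _)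
  have h4 : (μ.col j).card ≤ μ.card := Finset.card_le_card (Finset.filter_subset _ _)
  simp only [Finset.mem_product, Finset.mem_range]
  omega

open Classical in
/-- `H_{n,k}`: the partitions of `n` that do not contain the cell `(2, k)` (counted from `1`). -/
noncomputable def fattenedHooks (n k : ℕ) : Finset YoungDiagram :=
  (finite_card_eq n).toFinset.filter fun μ => ∀ c ∈ μ, (c.1 + 1, c.2 + 1) ≠ (2, k)

/-- The partition obtained from `μ ∈ H_{n,k+1}` by replacing its first part `μ₁` by `min μ₁ k`:
the cells of the first row beyond column `k` are deleted. It is a partition since `μ₂ ≤ k`. -/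
def capFirstRow {n k : ℕ} (μ : fattenedHooks n (k + 1)) : YoungDiagram where
  cells := μ.1.cells.filter fun c => c.1 = 0 → c.2 < k
  isLowerSet := by
    rintro ⟨i, j⟩ ⟨i', j'⟩ ⟨hi, hj⟩ h
    have hk := (Finset.mem_filter.1 μ.2).2
    simp only [Finset.coe_filter, YoungDiagram.mem_cells, Set.mem_ofPred_eq] at h hi hj ⊢
    refine ⟨μ.1.up_left_mem hi hj h.1, fun h0 => ?_⟩
    by_contra hlt
    rcases Nat.eq_zero_or_pos i with hi0 | hi0
    · have := h.2 hi0
      omega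
    · exact hk (1, k) (μ.1.up_left_mem hi0 (by omega) h.1) rfl

end PatternQSym

namespace PatternQSym

/-! ### Row insertion -/

/-! A coefficient of `Q n P` counts words. A permutation `σ` with an index sequence `i` contributing
to `fundamental n (descents σ)` is the same datum as the word `w = i ∘ σ⁻¹`, and `σ = Tuple.sort w`
is the inverse of the standardization of `w` (`coeff_Q`). Avoiding a partial shuffle then says: a
subsequence of `w` that is weakly increasing apart from its letter at index `a` is weakly increasing
altogether (`sort_mem_avoiders_iff`). With the theorem's `k` written as `k + 1`, these conditions
are `GoodTwo k` and `GoodOne k`.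

Both kinds of good words are encoded by the same pairs `(u, m)` (`IsPair`). Scanning a word, `split`
moves to `m` each letter that would complete a weakly increasing subsequence of length `k + 2` with
the kept letters. A `GoodTwo` word is recovered by writing `m` in sorted order after `u`, a
`GoodOne` word by inserting each letter of `m` as early as the pair condition permits (`weave`).
Contents are preserved, so the two generating functions agree (`goodEquiv`). The threshold for being
moved is an entry of the first row of the insertion tableau, by Schensted's theorem (`tab_le_iff`).

For the Schur expansion, group `GoodTwo` words by insertion tableau `T`. While the first row has
more than `k + 1` entries, the last letter must have been appended to that row, so it can be
stripped off in exactly one way. What remains is an arbitrary word whose tableau is `T` with its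
first row cut to `k + 1` columns (`nonempty_goodTwo_equiv`), and by the Robinson–Schensted
correspondence (`nonempty_tab_equiv`) such words are counted by standard tableaux of the capped
shape. This number depends only on the shape of `T`, so summing over `T` produces Schur functions.
-/

open Classical in
/-- The row obtained from `r` by row inserting `x`: the first entry larger than `x` is replaced
by `x`. Empty cells have the entry `⊤`. -/
noncomputable def bumpRow (r : ℕ → ℕ∞) (x : ℕ∞) : ℕ → ℕ∞ := fun j =>
  if x < r j ∧ ∀ i < j, r i ≤ x then x else r j

/-- The entry which is bumped from the row `r` by row inserting `x`. -/
noncomputable def bumpOut (r : ℕ → ℕ∞) (x : ℕ∞) : ℕ∞ := sInf {y | x < y ∧ ∃ j, r j = y}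

/-- Row inserting `x` into `r` gives `r'` and bumps `y`. -/
def BumpsTo (r : ℕ → ℕ∞) (x : ℕ∞) (r' : ℕ → ℕ∞) (y : ℕ∞) : Prop :=
  ∃ p, x < r p ∧ (∀ j < p, r j ≤ x) ∧ r' = Function.update r p x ∧ y = r p

/-- Every entry of the row `r` is smaller than the entry of the row `s` below it. -/
def ColLT (r s : ℕ → ℕ∞) : Prop := ∀ j, r j < s j ∨ s j = ⊤

/-- Monotonicity forces the position in `BumpsTo`, so the relation is the graph of the two
functions. The relation is the form that can be inverted. -/
theorem BumpsTo.eq {r r' : ℕ → ℕ∞} {x y : ℕ∞} (hr : Monotone r) (h : BumpsTo r x r' y) :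
    bumpRow r x = r' ∧ bumpOut r x = y := by
  obtain ⟨p, hp, hlt, rfl, rfl⟩ := h
  refine ⟨?_, ?_⟩
  · funext j
    unfold bumpRow
    rcases lt_trichotomy j p with hj | rfl | hj
    · rw [if_neg (fun h => (hlt j hj).not_gt h.1), Function.update_of_ne hj.ne]
    · rw [if_pos ⟨hp, hlt⟩, Function.update_self]
    · rw [if_neg (fun h => (h.2 _ hj).not_gt hp), Function.update_of_ne hj.ne']
  · apply le_antisymm
    · exact sInf_le ⟨hp, p, rfl⟩
    · refine le_sInf ?_
      rintro _ ⟨hx, j, rfl⟩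
      refine hr (le_of_not_gt fun hj => (hlt j hj).not_gt hx)

theorem bumpsTo_bumpRow {r : ℕ → ℕ∞} {x : ℕ∞} (hr : Monotone r) (h : ∃ j, x < r j) :
    BumpsTo r x (bumpRow r x) (bumpOut r x) := by
  classical
  have h1 : BumpsTo r x (Function.update r (Nat.find h) x) (r (Nat.find h)) :=
    ⟨Nat.find h, Nat.find_spec h, fun j hj => not_lt.1 (Nat.find_min h hj), rfl, rfl⟩
  obtain ⟨h2, h3⟩ := h1.eq hr
  rwa [h2, h3]

theorem BumpsTo.monotone {r r' : ℕ → ℕ∞} {x y : ℕ∞} (hr : Monotone r) (h : BumpsTo r x r' y) :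
    Monotone r' := by
  obtain ⟨p, hp, hlt, rfl, rfl⟩ := h
  intro i j hij
  have := hr hij
  rcases eq_or_ne p i with rfl | hi <;> rcases eq_or_ne p j with rfl | hj
  · exact le_rfl
  · rw [Function.update_self, Function.update_of_ne hj.symm]
    exact hp.le.trans this
  · rw [Function.update_self, Function.update_of_ne hi.symm]
    exact hlt i (lt_of_le_of_ne hij hi.symm)
  · rw [Function.update_of_ne hi.symm, Function.update_of_ne hj.symm]
    exact this

theorem BumpsTo.lt {r r' : ℕ → ℕ∞} {x y : ℕ∞} (h : BumpsTo r x r' y) : x < y := by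
  obtain ⟨p, hp, hlt, rfl, rfl⟩ := h
  exact hp

theorem BumpsTo.ne_top {r r' : ℕ → ℕ∞} {x y : ℕ∞} (h : BumpsTo r x r' y) : x ≠ ⊤ :=
  h.lt.ne_top

theorem BumpsTo.exists_eq {r r' : ℕ → ℕ∞} {x y : ℕ∞} (h : BumpsTo r x r' y) : ∃ j, r' j = x := by
  obtain ⟨p, hp, hlt, rfl, rfl⟩ := h
  exact ⟨p, by simp⟩

theorem BumpsTo.le {r r' : ℕ → ℕ∞} {x y : ℕ∞} (h : BumpsTo r x r' y) (j : ℕ) : r' j ≤ r j := by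
  obtain ⟨p, hp, hlt, rfl, rfl⟩ := h
  rcases eq_or_ne j p with rfl | hj
  · simpa using hp.le
  · simp [hj]

theorem BumpsTo.eq_top_iff {r r' : ℕ → ℕ∞} {x y : ℕ∞} (h : BumpsTo r x r' y) (hy : y ≠ ⊤) (j : ℕ) :
    r' j = ⊤ ↔ r j = ⊤ := by
  have hx := h.ne_top
  obtain ⟨p, hp, hlt, rfl, rfl⟩ := h
  rcases eq_or_ne j p with rfl | hj
  · simp [hx, hy]
  · simp [hj]

/-- Reverse bumping: `y` returns to the last position whose entry is smaller than `y` and expels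
that entry. -/
theorem exists_bumpsTo_of_lt {r' : ℕ → ℕ∞} {y : ℕ∞} (hr : Monotone r') (h : ∃ j, r' j < y)
    (h' : ∃ j, y ≤ r' j) : ∃ r x, Monotone r ∧ BumpsTo r x r' y := by
  classical
  obtain ⟨i, hi⟩ := h
  obtain ⟨p, hp⟩ : ∃ p, Nat.find h' = p + 1 := Nat.exists_eq_succ_of_ne_zero fun h0 => by
    have := Nat.find_spec h'
    rw [h0] at this
    exact (this.trans (hr i.zero_le)).not_gt hi
  have h1 : y ≤ r' (p + 1) := hp ▸ Nat.find_spec h'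
  have h2 : r' p < y := not_le.1 (Nat.find_min h' (by omega))
  refine ⟨Function.update r' p y, r' p, ?_, p, by simpa using h2, ?_, by simp, by simp⟩
  · intro i j hij
    rcases eq_or_ne p i with rfl | hi <;> rcases eq_or_ne p j with rfl | hj
    · exact le_rfl
    · rw [Function.update_self, Function.update_of_ne hj.symm]
      exact h1.trans (hr (by omega))
    · rw [Function.update_self, Function.update_of_ne hi.symm]
      exact (hr hij).trans h2.le
    · rw [Function.update_of_ne hi.symm, Function.update_of_ne hj.symm]
      exact hr hij
  · intro j hj
    rw [Function.update_of_ne hj.ne]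
    exact hr hj.le

theorem BumpsTo.unique {r₁ r₂ r' : ℕ → ℕ∞} {x₁ x₂ y : ℕ∞} (h₁ : Monotone r₁) (h₂ : Monotone r₂)
    (b₁ : BumpsTo r₁ x₁ r' y) (b₂ : BumpsTo r₂ x₂ r' y) : r₁ = r₂ ∧ x₁ = x₂ := by
  obtain ⟨p, hp, hlt, rfl, rfl⟩ := b₁
  obtain ⟨q, hq, hlt', he, he'⟩ := b₂
  have key : ∀ {r₁ r₂ : ℕ → ℕ∞} {x₁ x₂ : ℕ∞} {p q : ℕ}, Monotone r₂ → x₁ < r₁ p → r₁ p = r₂ q →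
      Function.update r₁ p x₁ = Function.update r₂ q x₂ → p ≤ q := by
    intro r₁ r₂ x₁ x₂ p q hm hp he' he
    by_contra! hlt
    have := congrFun he p
    rw [Function.update_self, Function.update_of_ne hlt.ne'] at this
    rw [he', this] at hp
    exact (hm hlt.le).not_gt hp
  obtain rfl : p = q := le_antisymm (key h₂ hp he' he) (key h₁ hq he'.symm he.symm)
  refine ⟨funext fun j => ?_, by simpa using congrFun he p⟩
  rcases eq_or_ne j p with rfl | hj
  · exact he'
  · simpa [hj] using congrFun he j

theorem ColLT.bump {r r' s s' : ℕ → ℕ∞} {x y z : ℕ∞} (h : ColLT r s)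
    (b : BumpsTo r x r' y) (c : BumpsTo s y s' z) : ColLT r' s' := by
  obtain ⟨p, hp, hlt, rfl, rfl⟩ := b
  obtain ⟨q, hq, hlt', rfl, rfl⟩ := c
  -- Bumped entries move weakly left: `y = r p` is smaller than the entry below it, so it cannot
  -- pass column `p`.
  have hqp : q ≤ p := by
    by_contra! hpq
    rcases h p with h | h
    · exact (hlt' p hpq).not_gt h
    · exact (h ▸ hlt' p hpq).not_gt (hq.trans_le le_top)
  intro j
  rcases eq_or_ne j q with rfl | hj
  · left
    rw [Function.update_self]
    rcases eq_or_ne j p with rfl | hjp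
    · simpa using hp
    · rw [Function.update_of_ne hjp]
      exact (hlt j (by omega)).trans_lt hp
  · rw [Function.update_of_ne hj]
    rcases eq_or_ne j p with rfl | hjp
    · rw [Function.update_self]
      exact (h j).imp_left hp.trans
    · rw [Function.update_of_ne hjp]
      exact h j

theorem ColLT.bump_top {r r' s : ℕ → ℕ∞} {x y : ℕ∞} (h : ColLT r s)
    (b : BumpsTo r x r' y) : ColLT r' s :=
  fun j => (h j).imp_left (b.le j).trans_lt

theorem ColLT.unbump {r r' s s' : ℕ → ℕ∞} {x y z : ℕ∞} (h : ColLT r' s') (hr : Monotone r) (hs : Monotone s)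
    (b : BumpsTo r x r' y) (c : BumpsTo s y s' z) : ColLT r s := by
  obtain ⟨p, hp, hlt, rfl, rfl⟩ := b
  obtain ⟨q, hq, hlt', rfl, rfl⟩ := c
  intro j
  have hj := h j
  rcases eq_or_ne j p with rfl | hjp
  · rcases eq_or_ne j q with rfl | hjq
    · exact Or.inl hq
    · rcases lt_or_gt_of_ne hjq with hlt2 | hlt2
      · exfalso
        have h1 := h q
        rw [Function.update_self, Function.update_of_ne hlt2.ne'] at h1
        exact (h1.resolve_right hq.ne_top).not_ge (hr hlt2.le)
      · exact Or.inl (hq.trans_le (hs hlt2.le))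
  · rw [Function.update_of_ne hjp] at hj
    rcases eq_or_ne j q with rfl | hjq
    · rw [Function.update_self] at hj
      refine Or.inl ((hj.resolve_right hq.ne_top).trans hq)
    · rwa [Function.update_of_ne hjq] at hj

/-! ### Insertion into tableaux -/

/-- The functions which are the filling of a semistandard tableau, where the cells outside of the
shape have the entry `⊤`. -/
structure IsTableau (T : ℕ → ℕ → ℕ∞) : Prop where
  monotone : ∀ i, Monotone (T i)
  colLT : ∀ i, ColLT (T i) (T (i + 1))
  bounded : ∃ N, ∀ i j, N ≤ i ∨ N ≤ j → T i j = ⊤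

/-- Row insertion of `x` into the tableau `T`. -/
noncomputable def rowInsert : (ℕ → ℕ → ℕ∞) → ℕ∞ → ℕ → ℕ → ℕ∞
  | T, x, 0 => bumpRow (T 0) x
  | T, x, i + 1 => rowInsert (fun i => T (i + 1)) (bumpOut (T 0) x) i

/-- Row inserting `x` into `U` gives `T`, and the new cell is in row `i`. -/
def Inserts : ℕ → (ℕ → ℕ → ℕ∞) → ℕ∞ → (ℕ → ℕ → ℕ∞) → Prop
  | 0, U, x, T => BumpsTo (U 0) x (T 0) ⊤ ∧ ∀ i, T (i + 1) = U (i + 1)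
  | i + 1, U, x, T => ∃ y, y ≠ ⊤ ∧ BumpsTo (U 0) x (T 0) y ∧
      Inserts i (fun a => U (a + 1)) y fun a => T (a + 1)

/-- The filling with first row `r` and the other rows given by `T`. -/
def consRow (r : ℕ → ℕ∞) (T : ℕ → ℕ → ℕ∞) : ℕ → ℕ → ℕ∞
  | 0 => r
  | i + 1 => T i

theorem IsTableau.tail {T : ℕ → ℕ → ℕ∞} (h : IsTableau T) : IsTableau fun i => T (i + 1) := by
  refine ⟨fun i => h.monotone _, fun i => h.colLT _, ?_⟩
  obtain ⟨N, hN⟩ := h.bounded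
  exact ⟨N, fun i j hij => hN _ _ (by omega)⟩

theorem rowInsert_top (T : ℕ → ℕ → ℕ∞) : rowInsert T ⊤ = T := by
  funext i
  induction i generalizing T with
  | zero => funext j; simp [rowInsert, bumpRow]
  | succ i ih =>
    have : bumpOut (T 0) ⊤ = ⊤ := by simp [bumpOut]
    rw [rowInsert, this, ih]

theorem Inserts.bumpsTo {i : ℕ} {U T : ℕ → ℕ → ℕ∞} {x : ℕ∞} (h : Inserts i U x T) :
    ∃ y, BumpsTo (U 0) x (T 0) y := by
  cases i with
  | zero => exact ⟨_, h.1⟩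
  | succ i =>
    obtain ⟨y, -, h, -⟩ := h
    exact ⟨y, h⟩

theorem Inserts.rowInsert_eq {i : ℕ} {U T : ℕ → ℕ → ℕ∞} {x : ℕ∞} (hU : ∀ i, Monotone (U i))
    (h : Inserts i U x T) : rowInsert U x = T := by
  induction i generalizing U T x with
  | zero =>
    obtain ⟨h1, h2⟩ := h
    obtain ⟨h3, h4⟩ := h1.eq (hU 0)
    funext i
    cases i with
    | zero => exact h3
    | succ i => rw [rowInsert, h4, rowInsert_top, h2]
  | succ i ih =>
    obtain ⟨y, -, h1, h2⟩ := h
    obtain ⟨h3, h4⟩ := h1.eq (hU 0)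
    funext i
    cases i with
    | zero => exact h3
    | succ i => rw [rowInsert, h4, ih (fun i => hU _) h2]

theorem IsTableau.exists_inserts {U : ℕ → ℕ → ℕ∞} (h : IsTableau U) {x : ℕ∞} (hx : x ≠ ⊤) :
    ∃ i, Inserts i U x (rowInsert U x) := by
  obtain ⟨N, hN⟩ := h.bounded
  replace hN : ∀ i j, N ≤ i → U i j = ⊤ := fun i j hi => hN i j (Or.inl hi)
  induction N generalizing U x with
  | zero =>
    have hb := bumpsTo_bumpRow (x := x) (h.monotone 0) ⟨0, by rw [hN 0 0 le_rfl]; exact hx.lt_top⟩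
    have : bumpOut (U 0) x = ⊤ := by
      obtain ⟨p, -, -, -, hp⟩ := hb
      rw [hp, hN 0 _ le_rfl]
    refine ⟨0, this ▸ hb, fun i => ?_⟩
    rw [rowInsert, this, rowInsert_top]
  | succ N ih =>
    obtain ⟨M, hM⟩ := h.bounded
    have hb := bumpsTo_bumpRow (x := x) (h.monotone 0)
      ⟨M, by rw [hM 0 M (Or.inr le_rfl)]; exact hx.lt_top⟩
    by_cases hy : bumpOut (U 0) x = ⊤
    · refine ⟨0, hy ▸ hb, fun i => ?_⟩
      rw [rowInsert, hy, rowInsert_top]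
    · obtain ⟨i, hi⟩ := ih h.tail hy fun i j hij => hN _ _ (by omega)
      exact ⟨i + 1, _, hy, hb, hi⟩

theorem Inserts.le {i : ℕ} {U T : ℕ → ℕ → ℕ∞} {x : ℕ∞} (h : Inserts i U x T) (a b : ℕ) :
    T a b ≤ U a b := by
  induction i generalizing U T x a with
  | zero =>
    cases a with
    | zero => exact h.1.le b
    | succ a => rw [h.2]
  | succ i ih =>
    obtain ⟨y, -, h1, h2⟩ := h
    cases a with
    | zero => exact h1.le b
    | succ a => exact ih h2 a

/-- Above row `i` one finite entry replaces another; only row `i`, which bumps `⊤`, gains a cell. -/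
theorem Inserts.shape {i : ℕ} {U T : ℕ → ℕ → ℕ∞} {x : ℕ∞} (h : Inserts i U x T) :
    ∃ j, U i j = ⊤ ∧ ∀ a b, T a b = ⊤ ↔ U a b = ⊤ ∧ ¬ (a = i ∧ b = j) := by
  induction i generalizing U T x with
  | zero =>
    obtain ⟨h1, h2⟩ := h
    have hx := h1.ne_top
    obtain ⟨p, hp, hlt, he, hy⟩ := h1
    refine ⟨p, hy.symm, fun a b => ?_⟩
    cases a with
    | zero =>
      rw [he]
      rcases eq_or_ne b p with rfl | hb
      · simp [hx]
      · simp [hb]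
    | succ a => simp [h2]
  | succ i ih =>
    obtain ⟨y, hy, h1, h2⟩ := h
    obtain ⟨j, hj, hs⟩ := ih h2
    refine ⟨j, hj, fun a b => ?_⟩
    cases a with
    | zero => simp [h1.eq_top_iff hy]
    | succ a => simpa using hs a b

theorem Inserts.isTableau {i : ℕ} {U T : ℕ → ℕ → ℕ∞} {x : ℕ∞} (hU : IsTableau U)
    (h : Inserts i U x T) : IsTableau T := by
  have hb : ∃ N, ∀ i j, N ≤ i ∨ N ≤ j → T i j = ⊤ := by
    obtain ⟨N, hN⟩ := hU.bounded
    obtain ⟨j, -, hs⟩ := h.shape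
    refine ⟨max N (max (i + 1) (j + 1)), fun a b hab => (hs a b).2 ⟨hN a b ?_, ?_⟩⟩
    all_goals omega
  have : (∀ a, Monotone (T a)) ∧ ∀ a, ColLT (T a) (T (a + 1)) := by
    clear hb
    induction i generalizing U T x with
    | zero =>
      obtain ⟨h1, h2⟩ := h
      constructor
      · rintro (_ | a)
        · exact h1.monotone (hU.monotone 0)
        · exact h2 a ▸ hU.monotone _
      · rintro (_ | a)
        · rw [h2]
          exact (hU.colLT 0).bump_top h1
        · rw [h2, h2]
          exact hU.colLT _
    | succ i ih =>
      obtain ⟨y, hy, h1, h2⟩ := h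
      obtain ⟨h3, h4⟩ := ih hU.tail h2
      obtain ⟨z, hz⟩ := h2.bumpsTo
      constructor
      · rintro (_ | a)
        · exact h1.monotone (hU.monotone 0)
        · exact h3 a
      · rintro (_ | a)
        · exact (hU.colLT 0).bump h1 hz
        · exact h4 a
  exact ⟨this.1, this.2, hb⟩

theorem Inserts.unique {i : ℕ} {U₁ U₂ T : ℕ → ℕ → ℕ∞} {x₁ x₂ : ℕ∞} (hU₁ : ∀ i, Monotone (U₁ i))
    (hU₂ : ∀ i, Monotone (U₂ i)) (h₁ : Inserts i U₁ x₁ T) (h₂ : Inserts i U₂ x₂ T) :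
    U₁ = U₂ ∧ x₁ = x₂ := by
  induction i generalizing U₁ U₂ T x₁ x₂ with
  | zero =>
    obtain ⟨h3, h4⟩ := h₁.1.unique (hU₁ 0) (hU₂ 0) h₂.1
    refine ⟨funext fun a => ?_, h4⟩
    cases a with
    | zero => exact h3
    | succ a => rw [← h₁.2, ← h₂.2]
  | succ i ih =>
    obtain ⟨y₁, -, a₁, b₁⟩ := h₁
    obtain ⟨y₂, -, a₂, b₂⟩ := h₂
    obtain ⟨h3, rfl⟩ := ih (fun i => hU₁ _) (fun i => hU₂ _) b₁ b₂
    obtain ⟨h4, h5⟩ := a₁.unique (hU₁ 0) (hU₂ 0) a₂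
    refine ⟨funext fun a => ?_, h5⟩
    cases a with
    | zero => exact h4
    | succ a => exact congrFun h3 a

/-- Reverse row insertion, starting from a corner and bumping upwards row by row. -/
theorem IsTableau.exists_uninsert {T : ℕ → ℕ → ℕ∞} (hT : IsTableau T) {i j : ℕ} (h : T i j ≠ ⊤)
    (hr : T i (j + 1) = ⊤) (hc : T (i + 1) j = ⊤) : ∃ U x, IsTableau U ∧ Inserts i U x T := by
  obtain ⟨N, hN⟩ := hT.bounded
  induction i generalizing T N with
  | zero =>
    obtain ⟨r, x, hm, hb⟩ := exists_bumpsTo_of_lt (hT.monotone 0) ⟨j, h.lt_top⟩ ⟨j + 1, hr.ge⟩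
    have hI : Inserts 0 (consRow r fun a => T (a + 1)) x T := ⟨hb, fun _ => rfl⟩
    refine ⟨_, x, ⟨?_, ?_, N, fun a b hab => ?_⟩, hI⟩
    · rintro (_ | a)
      · exact hm
      · exact hT.monotone _
    · rintro (_ | a)
      · have h1 := hb.ne_top
        obtain ⟨p, hp, hlt, he, hy⟩ := hb
        -- `T 0 p` is the finite letter `x`, while the row is empty from column `j + 1` on.
        have hpj : p ≤ j := by
          by_contra! hlt2
          have h2 := hT.monotone 0 (Nat.succ_le_of_lt hlt2)
          rw [Nat.succ_eq_add_one, hr, he, Function.update_self] at h2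
          exact h1 (top_le_iff.1 h2)
        intro b
        have h3 := hT.colLT 0 b
        rw [he] at h3
        rcases eq_or_ne b p with rfl | hb
        · right
          obtain rfl : b = j := by
            by_contra hbj
            rw [he, Function.update_of_ne (Ne.symm hbj)] at h
            exact h (top_le_iff.1 (hy.trans_le (hm hpj)))
          exact hc
        · simpa [hb, consRow] using h3
      · exact hT.colLT _
    · have := hI.le a b
      rw [hN a b hab] at this
      exact top_le_iff.1 this
  | succ i ih =>
    obtain ⟨V, y, hV, hI⟩ := ih hT.tail h hr hc N fun a b hab => hN _ _ (by omega)
    obtain ⟨z, hz⟩ := hI.bumpsTo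
    obtain ⟨q, hq⟩ := hz.exists_eq
    -- The entry above an occurrence of `y` is smaller than `y`, so reverse bumping applies to the
    -- row above.
    have hlt : T 0 q < y := by
      rcases hT.colLT 0 q with h1 | h1
      · exact hq ▸ h1
      · exact (hz.ne_top (hq.symm.trans h1)).elim
    obtain ⟨r, x, hm, hb⟩ := exists_bumpsTo_of_lt (hT.monotone 0) ⟨q, hlt⟩
      ⟨N, (hN 0 N (Or.inr le_rfl)).ge.trans' le_top⟩
    have hI' : Inserts (i + 1) (consRow r V) x T := ⟨y, hz.ne_top, hb, hI⟩
    refine ⟨_, x, ⟨?_, ?_, N, fun a b hab => ?_⟩, hI'⟩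
    · rintro (_ | a)
      · exact hm
      · exact hV.monotone _
    · rintro (_ | a)
      · exact (hT.colLT 0).unbump hm (hV.monotone 0) hb hz
      · exact hV.colLT _
    · have := hI'.le a b
      rw [hN a b hab] at this
      exact top_le_iff.1 this

theorem BumpsTo.sum_eq {M : Type*} [AddCommMonoid M] {f : ℕ∞ → M} {r r' : ℕ → ℕ∞} {x y : ℕ∞}
    (h : BumpsTo r x r' y) {N : ℕ} (hN : ∀ j, N ≤ j → r' j = ⊤) :
    ∑ j ∈ Finset.range N, f (r' j) + f y = ∑ j ∈ Finset.range N, f (r j) + f x := by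
  have hx := h.ne_top
  obtain ⟨p, hp, -, rfl, rfl⟩ := h
  have hpN : p ∈ Finset.range N := by
    rw [Finset.mem_range]
    by_contra! hle
    exact hx (by simpa using hN p hle)
  rw [← Finset.add_sum_erase _ _ hpN, ← Finset.add_sum_erase _ (fun j => f (r j)) hpN,
    Function.update_self, Finset.sum_congr rfl (g := fun j => f (r j))]
  · ac_rfl
  · intro j hj
    rw [Function.update_of_ne (Finset.ne_of_mem_erase hj)]

/-- Each bumped entry leaves one row and enters the next, so its contributions cancel and only `x`
is new. -/
theorem Inserts.sum_eq {M : Type*} [AddCommMonoid M] {f : ℕ∞ → M} (hf : f ⊤ = 0) {i : ℕ}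
    {U T : ℕ → ℕ → ℕ∞} {x : ℕ∞} (h : Inserts i U x T) {L N : ℕ}
    (hN : ∀ i j, L ≤ i ∨ N ≤ j → T i j = ⊤) :
    ∑ i ∈ Finset.range L, ∑ j ∈ Finset.range N, f (T i j) =
      ∑ i ∈ Finset.range L, ∑ j ∈ Finset.range N, f (U i j) + f x := by
  induction i generalizing U T x L with
  | zero =>
    obtain ⟨h1, h2⟩ := h
    cases L with
    | zero =>
      obtain ⟨p, hp⟩ := h1.exists_eq
      exact (h1.ne_top (hp.symm.trans (hN 0 p (by omega)))).elim
    | succ L =>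
      have := h1.sum_eq (f := f) fun j hj => hN 0 j (Or.inr hj)
      rw [hf, add_zero] at this
      rw [Finset.sum_range_succ', Finset.sum_range_succ', this, add_assoc]
      simp only [h2]
  | succ i ih =>
    obtain ⟨y, hy, h1, h2⟩ := h
    cases L with
    | zero =>
      obtain ⟨p, hp⟩ := h1.exists_eq
      exact (h1.ne_top (hp.symm.trans (hN 0 p (by omega)))).elim
    | succ L =>
      have := h1.sum_eq (f := f) fun j hj => hN 0 j (Or.inr hj)
      have h3 := ih h2 (L := L) fun a b hab => hN _ _ (by omega)
      rw [Finset.sum_range_succ', Finset.sum_range_succ', h3, add_assoc, add_assoc, ← this,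
        add_comm (f y)]

/-! ### Words

Words are represented by lists in reverse order: the head of the list is the last letter. -/

/-- The insertion tableau of a word. -/
noncomputable def tab : List ℕ → ℕ → ℕ → ℕ∞
  | [] => fun _ _ => ⊤
  | x :: u => rowInsert (tab u) x

theorem isTableau_tab (u : List ℕ) : IsTableau (tab u) := by
  induction u with
  | nil => exact ⟨fun _ _ _ _ => le_rfl, fun _ _ => Or.inr rfl, 0, fun _ _ _ => rfl⟩
  | cons x u ih =>
    obtain ⟨i, hi⟩ := ih.exists_inserts (ENat.natCast_ne_top x)
    exact hi.isTableau ih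

theorem exists_inserts_tab (x : ℕ) (u : List ℕ) : ∃ i, Inserts i (tab u) x (tab (x :: u)) :=
  (isTableau_tab u).exists_inserts (ENat.natCast_ne_top x)

theorem exists_bumpsTo_tab (x : ℕ) (u : List ℕ) :
    ∃ y, BumpsTo (tab u 0) x (tab (x :: u) 0) y := by
  obtain ⟨i, hi⟩ := exists_inserts_tab x u
  exact hi.bumpsTo

theorem tab_cons_le_iff (y : ℕ) (u : List ℕ) (j : ℕ) (z : ℕ∞) :
    tab (y :: u) 0 j ≤ z ↔ tab u 0 j ≤ z ∨ y ≤ z ∧ ∀ i < j, tab u 0 i ≤ y := by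
  have hm := (isTableau_tab u).monotone 0
  obtain ⟨-, p, hp, hlt, he, -⟩ := exists_bumpsTo_tab y u
  rw [he]
  rcases lt_trichotomy j p with hj | rfl | hj
  · rw [Function.update_of_ne hj.ne]
    exact ⟨Or.inl, fun h => h.elim id fun h => (hlt j hj).trans h.1⟩
  · rw [Function.update_self]
    exact ⟨fun h => Or.inr ⟨h, hlt⟩, fun h => h.elim (fun h => hp.le.trans h) And.left⟩
  · rw [Function.update_of_ne hj.ne']
    exact ⟨Or.inl, fun h => h.elim id fun h => ((h.2 p hj).not_gt hp).elim⟩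

/-- Schensted's theorem: the first row records the smallest possible ends of weakly increasing
subsequences. Both sides obey the same recursion when a last letter is added. -/
theorem tab_le_iff (u : List ℕ) (j x : ℕ) : tab u 0 j ≤ x ↔
    ∃ l : List ℕ, l.Sublist u ∧ l.length = j + 1 ∧ l.Pairwise (· ≥ ·) ∧ ∀ z ∈ l, z ≤ x := by
  induction u generalizing j x with
  | nil =>
    refine ⟨fun h => ?_, ?_⟩
    · exact (ENat.natCast_ne_top x (top_le_iff.1 h)).elim
    · rintro ⟨l, hl, hl', -⟩
      rw [List.sublist_nil.1 hl] at hl'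
      simp at hl'
  | cons y u ih =>
    rw [tab_cons_le_iff, ih]
    constructor
    · rintro (⟨l, h1, h2⟩ | ⟨h1, h2⟩)
      · exact ⟨l, h1.cons y, h2⟩
      · replace h1 : y ≤ x := by exact_mod_cast h1
        cases j with
        | zero => exact ⟨[y], by simp, rfl, by simp, by simpa using h1⟩
        | succ j =>
          obtain ⟨l, h3, h4, h5, h6⟩ := (ih j y).1 (h2 j (by omega))
          refine ⟨y :: l, h3.cons_cons y, by simp [h4], List.pairwise_cons.2 ⟨h6, h5⟩, ?_⟩
          rintro z (_ | ⟨_, hz⟩)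
          · exact h1
          · exact (h6 z hz).trans h1
    · rintro ⟨l, h1, h2, h3, h4⟩
      rcases List.sublist_cons_iff.1 h1 with h1 | ⟨l, rfl, h5⟩
      · exact Or.inl ⟨l, h1, h2, h3, h4⟩
      · refine Or.inr ⟨by exact_mod_cast h4 y (by simp), fun i hi => ?_⟩
        cases j with
        | zero => omega
        | succ j =>
          rw [List.pairwise_cons] at h3
          exact ((isTableau_tab u).monotone 0 (Nat.le_of_lt_succ hi)).trans
            ((ih j y).2 ⟨l, h5, by simpa using h2, h3.2, h3.1⟩)

theorem tab_eq_top_iff (u : List ℕ) (j : ℕ) : tab u 0 j = ⊤ ↔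
    ∀ l : List ℕ, l.Sublist u → l.length = j + 1 → ¬ l.Pairwise (· ≥ ·) := by
  constructor
  · intro h l h1 h2 h3
    -- Any upper bound for the letters would do; the sum is one.
    have := (tab_le_iff u j (l.sum)).2 ⟨l, h1, h2, h3, fun z hz => List.le_sum_of_mem hz⟩
    rw [h] at this
    exact ENat.natCast_ne_top _ (top_le_iff.1 this)
  · intro h
    by_contra hne
    obtain ⟨x, hx⟩ := ENat.ne_top_iff_exists.1 hne
    obtain ⟨l, h1, h2, h3, -⟩ := (tab_le_iff u j x).1 hx.ge
    exact h l h1 h2 h3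

/-! ### Good words and the bijection through pairs -/

/-- The words corresponding to the permutations which avoid `Π_{k+1,2}`. -/
def GoodTwo (k : ℕ) (v : List ℕ) : Prop :=
  ∀ (y : ℕ) (l : List ℕ), (y :: l).Sublist v → l.length = k + 2 → l.Pairwise (· ≥ ·) →
    (y :: l).Pairwise (· ≥ ·)

/-- The words corresponding to the permutations which avoid `Π_{k+1,1}`. -/
def GoodOne (k : ℕ) (v : List ℕ) : Prop :=
  ∀ (y x : ℕ) (l : List ℕ), (y :: x :: l).Sublist v → l.length = k + 1 →
    (y :: l).Pairwise (· ≥ ·) → (y :: x :: l).Pairwise (· ≥ ·)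

theorem GoodTwo.of_cons {k y : ℕ} {v : List ℕ} (h : GoodTwo k (y :: v)) : GoodTwo k v :=
  fun z l hl => h z l (hl.cons y)

theorem GoodOne.of_cons {k y : ℕ} {v : List ℕ} (h : GoodOne k (y :: v)) : GoodOne k v :=
  fun z x l hl => h z x l (hl.cons y)

theorem GoodTwo.cons {k y : ℕ} {v : List ℕ} (h : GoodTwo k v) (h' : ∀ l : List ℕ, l.Sublist v →
    l.length = k + 2 → l.Pairwise (· ≥ ·) → (y :: l).Pairwise (· ≥ ·)) : GoodTwo k (y :: v) := by
  intro z l hl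
  rcases List.sublist_cons_iff.1 hl with hl | ⟨l', he, hl⟩
  · exact h z l hl
  · obtain ⟨rfl, rfl⟩ := List.cons_eq_cons.1 he
    exact h' l hl

theorem GoodOne.cons {k y : ℕ} {v : List ℕ} (h : GoodOne k v) (h' : ∀ (x : ℕ) (l : List ℕ),
    (x :: l).Sublist v → l.length = k + 1 → (y :: l).Pairwise (· ≥ ·) →
      (y :: x :: l).Pairwise (· ≥ ·)) : GoodOne k (y :: v) := by
  intro z x l hl
  rcases List.sublist_cons_iff.1 hl with hl | ⟨l', he, hl⟩
  · exact h z x l hl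
  · obtain ⟨rfl, rfl⟩ := List.cons_eq_cons.1 he
    exact h' x l hl

/-- `u` has no weakly increasing subsequence of length `k + 2`, and `m` is a weakly increasing word
whose letters are at least the smallest end of a weakly increasing subsequence of `u` of length
`k + 1`. -/
structure IsPair (k : ℕ) (u m : List ℕ) : Prop where
  top : tab u 0 (k + 1) = ⊤
  pairwise : m.Pairwise (· ≥ ·)
  le : ∀ z ∈ m, tab u 0 k ≤ z

open Classical in
/-- Split a word into the letters which do not end a weakly increasing subsequence of length
`k + 2` and the sorted list of the other letters. -/
noncomputable def split (k : ℕ) : List ℕ → List ℕ × List ℕ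
  | [] => ([], [])
  | y :: v => if tab (split k v).1 0 k ≤ y then
      ((split k v).1, (split k v).2.orderedInsert (· ≥ ·) y)
    else (y :: (split k v).1, (split k v).2)

open Classical in
/-- The word obtained from `u` by inserting each letter `z` of `m` after the first letter of `u`
that is at most `z` and ends a weakly increasing subsequence of length `k + 1`. -/
noncomputable def weave (k : ℕ) : List ℕ → List ℕ → List ℕ
  | [], m => m
  | x :: u, m => m.filter (fun z : ℕ => decide ((z : ℕ∞) < tab u 0 k)) ++
      x :: weave k u (m.filter fun z : ℕ => !decide ((z : ℕ∞) < tab u 0 k))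

theorem split_perm (k : ℕ) (v : List ℕ) : ((split k v).2 ++ (split k v).1).Perm v := by
  induction v with
  | nil => exact List.Perm.refl _
  | cons y v ih =>
    rw [split]
    split_ifs
    · exact ((List.perm_orderedInsert (· ≥ ·) y _).append_right _).trans (ih.cons y)
    · exact List.perm_middle.trans (ih.cons y)

theorem tab_cons_succ_eq_top {k y : ℕ} {u : List ℕ} (h : tab u 0 (k + 1) = ⊤)
    (hy : ¬ tab u 0 k ≤ y) : tab (y :: u) 0 (k + 1) = ⊤ := by
  by_contra hne
  obtain ⟨z, hz⟩ := ENat.ne_top_iff_exists.1 hne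
  rcases (tab_cons_le_iff y u (k + 1) z).1 hz.ge with h1 | h1
  · rw [h] at h1
    exact ENat.natCast_ne_top z (top_le_iff.1 h1)
  · exact hy (h1.2 k (by omega))

theorem not_le_of_tab_cons_eq_top {k y : ℕ} {u : List ℕ} (h : tab (y :: u) 0 (k + 1) = ⊤) :
    ¬ tab u 0 k ≤ y := by
  intro hy
  have := (tab_cons_le_iff y u (k + 1) y).2
    (Or.inr ⟨le_rfl, fun i hi => ((isTableau_tab u).monotone 0 (Nat.le_of_lt_succ hi)).trans hy⟩)
  rw [h] at this
  exact ENat.natCast_ne_top y (top_le_iff.1 this)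

theorem tab_cons_le (y : ℕ) (u : List ℕ) (j : ℕ) : tab (y :: u) 0 j ≤ tab u 0 j :=
  (tab_cons_le_iff y u j _).2 (Or.inl le_rfl)

theorem tab_eq_top_of_cons {j y : ℕ} {u : List ℕ} (h : tab (y :: u) 0 j = ⊤) : tab u 0 j = ⊤ :=
  top_le_iff.1 (h ▸ tab_cons_le y u j)

theorem isPair_split (k : ℕ) (v : List ℕ) : IsPair k (split k v).1 (split k v).2 := by
  induction v with
  | nil => exact ⟨rfl, List.Pairwise.nil, by simp [split]⟩
  | cons y v ih =>
    rw [split]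
    split_ifs with h
    · refine ⟨ih.top, ih.pairwise.orderedInsert y _, fun z hz => ?_⟩
      rcases (List.mem_orderedInsert _).1 hz with rfl | hz
      · exact h
      · exact ih.le z hz
    · exact ⟨tab_cons_succ_eq_top ih.top h, ih.pairwise,
        fun z hz => (tab_cons_le _ _ _).trans (ih.le z hz)⟩

/-- A removed letter is at least entry `k` of the first row, so it cannot lower any entry up to
column `k`. Hence the threshold may be read off from the whole word or from the kept part. -/
theorem tab_split {k j : ℕ} (hj : j ≤ k) (v : List ℕ) : tab (split k v).1 0 j = tab v 0 j := by
  induction v generalizing j with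
  | nil => rfl
  | cons y v ih =>
    refine eq_of_forall_ge_iff fun z => ?_
    rw [split]
    split_ifs with h
    · rw [ih hj, tab_cons_le_iff]
      refine ⟨Or.inl, fun h' => h'.elim id fun h' => ?_⟩
      rw [← ih hj]
      exact ((isTableau_tab _).monotone 0 hj).trans (h.trans h'.1)
    · rw [tab_cons_le_iff, tab_cons_le_iff, ih hj]
      refine or_congr_right (and_congr_right fun _ => forall₂_congr fun i hi => ?_)
      rw [ih (by omega)]

theorem split_append_fst {k : ℕ} {m v : List ℕ} (h : ∀ z ∈ m, tab v 0 k ≤ z) :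
    (split k (m ++ v)).1 = (split k v).1 := by
  induction m with
  | nil => rfl
  | cons y m ih =>
    have h1 := ih fun z hz => h z (List.mem_cons_of_mem y hz)
    rw [List.cons_append, split, if_pos, h1]
    rw [h1, tab_split le_rfl]
    exact h y (by simp)

theorem split_fst_of_top {k : ℕ} {u : List ℕ} (h : tab u 0 (k + 1) = ⊤) : (split k u).1 = u := by
  induction u with
  | nil => rfl
  | cons y u ih =>
    have h1 := ih (tab_eq_top_of_cons h)
    rw [split, h1, if_neg (not_le_of_tab_cons_eq_top h)]

/-- Only the kept part needs checking: the content of `v` then determines the sorted remainder. -/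
theorem IsPair.split_eq {k : ℕ} {u m v : List ℕ} (h : IsPair k u m) (hp : v.Perm (m ++ u))
    (hv : (split k v).1 = u) : split k v = (u, m) := by
  refine Prod.ext hv ?_
  have h1 := (split_perm k v).trans hp
  rw [hv, List.perm_append_right_iff] at h1
  exact h1.eq_of_pairwise' (r := (· ≥ ·)) (isPair_split k v).pairwise h.pairwise

theorem IsPair.split_append {k : ℕ} {u m : List ℕ} (h : IsPair k u m) :
    split k (m ++ u) = (u, m) :=
  h.split_eq (List.Perm.refl _) ((split_append_fst h.le).trans (split_fst_of_top h.top))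

theorem IsPair.goodTwo {k : ℕ} {u m : List ℕ} (h : IsPair k u m) : GoodTwo k (m ++ u) := by
  have h1 := (tab_eq_top_iff u (k + 1)).1 h.top
  have hm := h.pairwise
  clear h
  induction m with
  | nil =>
    intro y l hl hlen hp
    exact (h1 l ((List.sublist_cons_self y l).trans hl) hlen hp).elim
  | cons y m ih =>
    rw [List.pairwise_cons] at hm
    refine (ih hm.2).cons fun l hl hlen hp => ?_
    obtain ⟨l₁, l₂, rfl, h2, h3⟩ := List.sublist_append_iff.1 hl
    cases l₁ with
    | nil => exact (h1 _ h3 hlen hp).elim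
    | cons c l₁ =>
      have hyc := hm.1 c (h2.subset (by simp))
      refine List.pairwise_cons.2 ⟨fun z hz => ?_, hp⟩
      rcases List.mem_cons.1 hz with rfl | hz
      · exact hyc
      · exact ((List.pairwise_cons.1 hp).1 z hz).trans hyc

/-- Every moved letter ends a weakly increasing subsequence of length `k + 2`, so in a good word no
later letter is smaller. The moved letters thus form an already sorted final block. -/
theorem GoodTwo.split_append {k : ℕ} {v : List ℕ} (h : GoodTwo k v) :
    (split k v).2 ++ (split k v).1 = v := by
  induction v with
  | nil => rfl
  | cons y v ih =>
    have h1 := ih h.of_cons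
    have hP := isPair_split k v
    have key : ∀ b ∈ (split k v).2, b ≤ y := by
      intro b hb
      obtain ⟨l, h2, h3, h4, h5⟩ := (tab_le_iff _ _ _).1 (hP.le b hb)
      have h6 : (y :: b :: l).Sublist (y :: v) := by
        refine List.Sublist.cons_cons y ?_
        rw [← h1]
        exact (List.singleton_sublist.2 hb).append h2
      have h7 := h y (b :: l) h6 (by simp [h3]) (List.pairwise_cons.2 ⟨h5, h4⟩)
      exact (List.pairwise_cons.1 h7).1 b (by simp)
    rw [split]
    split_ifs with hy
    · have : (split k v).2.orderedInsert (· ≥ ·) y = y :: (split k v).2 :=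
        (List.perm_orderedInsert (· ≥ ·) y _).eq_of_pairwise' (r := (· ≥ ·))
          (hP.pairwise.orderedInsert y _) (List.pairwise_cons.2 ⟨key, hP.pairwise⟩)
      simp [this, h1]
    · have : (split k v).2 = [] := by
        refine List.eq_nil_iff_forall_not_mem.2 fun b hb => hy ?_
        exact (hP.le b hb).trans (by exact_mod_cast key b hb)
      rw [this, List.nil_append] at h1
      simp [this, h1]

theorem weave_perm (k : ℕ) (u m : List ℕ) : (weave k u m).Perm (m ++ u) := by
  classical
  induction u generalizing m with
  | nil => simp [weave]
  | cons x u ih =>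
    rw [weave]
    refine (((ih _).cons x).append_left _).trans ?_
    refine (List.perm_middle.trans ?_).trans List.perm_middle.symm
    refine List.Perm.cons x ?_
    rw [← List.append_assoc]
    refine List.Perm.append_right _ ?_
    exact List.filter_append_perm (fun z : ℕ => decide ((z : ℕ∞) < tab u 0 k)) m

theorem IsPair.filter {k x : ℕ} {u m : List ℕ} (h : IsPair k (x :: u) m) :
    IsPair k u (m.filter fun z : ℕ => !decide ((z : ℕ∞) < tab u 0 k)) :=
  ⟨tab_eq_top_of_cons h.top, h.pairwise.filter _, fun z hz => by
    simpa using (List.mem_filter.1 hz).2⟩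

theorem IsPair.split_cons_fst {k x : ℕ} {u m v : List ℕ} (h : IsPair k (x :: u) m)
    (hv : (split k v).1 = u) : (split k (x :: v)).1 = x :: u := by
  rw [split, hv, if_neg (not_le_of_tab_cons_eq_top h.top)]

/-- Inserted letters lie above the threshold where they are placed, so `split` moves them and keeps
exactly `u`. -/
theorem IsPair.split_weave {k : ℕ} {u m : List ℕ} (h : IsPair k u m) :
    split k (weave k u m) = (u, m) := by
  refine h.split_eq (weave_perm k u m) ?_
  induction u generalizing m with
  | nil =>
    have : m = [] := List.eq_nil_iff_forall_not_mem.2 fun z hz =>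
      ENat.natCast_ne_top z (top_le_iff.1 (h.le z hz))
    subst this
    rfl
  | cons x u ih =>
    have h2 := h.split_cons_fst (ih h.filter)
    rw [weave, split_append_fst, h2]
    intro z hz
    rw [← tab_split le_rfl, h2]
    exact h.le z (List.mem_of_mem_filter hz)

theorem IsPair.tab_weave {k : ℕ} {u m : List ℕ} (h : IsPair k u m) :
    tab (weave k u m) 0 k = tab u 0 k := by
  rw [← tab_split le_rfl, h.split_weave]

theorem IsPair.goodOne {k : ℕ} {u m : List ℕ} (h : IsPair k u m) : GoodOne k (weave k u m) := by
  induction u generalizing m with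
  | nil =>
    have : m = [] := List.eq_nil_iff_forall_not_mem.2 fun z hz =>
      ENat.natCast_ne_top z (top_le_iff.1 (h.le z hz))
    subst this
    intro y x l hl
    simp [weave] at hl
  | cons x u ih =>
    have h1 := h.filter.tab_weave
    have hg := ih h.filter
    rw [weave]
    set v := weave k u (m.filter fun z : ℕ => !decide ((z : ℕ∞) < tab u 0 k))
    -- A letter below the threshold of `v` cannot follow a weakly increasing subsequence of length
    -- `k + 1` of `v`.
    have hlow : ∀ b : ℕ, (b : ℕ∞) < tab u 0 k → ∀ l : List ℕ, l.Sublist v → l.length = k + 1 →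
        ¬ (b :: l).Pairwise (· ≥ ·) := by
      intro b hb l hl hlen hp
      rw [List.pairwise_cons] at hp
      exact (h1 ▸ (tab_le_iff v k b).2 ⟨l, hl, hlen, hp.2, hp.1⟩).not_gt hb
    -- These letters became admissible only through `x`, which must therefore be at most each of
    -- them.
    have hB : ∀ b ∈ m.filter (fun z : ℕ => decide ((z : ℕ∞) < tab u 0 k)), (b : ℕ∞) < tab u 0 k ∧ x ≤ b := by
      intro b hb
      rw [List.mem_filter] at hb
      have hb2 : (b : ℕ∞) < tab u 0 k := by simpa using hb.2
      refine ⟨hb2, ?_⟩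
      rcases (tab_cons_le_iff x u k b).1 (h.le b hb.1) with h3 | h3
      · exact (h3.not_gt hb2).elim
      · exact_mod_cast h3.1
    have hP := h.pairwise.filter (fun z : ℕ => decide ((z : ℕ∞) < tab u 0 k))
    generalize m.filter (fun z : ℕ => decide ((z : ℕ∞) < tab u 0 k)) = B at hB hP
    induction B with
    | nil =>
      refine hg.cons fun x' l hl hlen hp => ?_
      exact (hlow x (not_le.1 (not_le_of_tab_cons_eq_top h.top)) l
        ((List.sublist_cons_self _ _).trans hl) hlen hp).elim
    | cons b B ihB =>
      rw [List.pairwise_cons] at hP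
      refine (ihB (fun c hc => hB c (List.mem_cons_of_mem b hc)) hP.2).cons ?_
      intro x' l hl hlen hp
      have hb := (hB b (by simp)).1
      obtain ⟨s₁, s₂, he, h2, h3⟩ := List.sublist_append_iff.1 hl
      cases s₁ with
      | nil =>
        rw [List.nil_append] at he
        rw [← he] at h3
        rcases List.sublist_cons_iff.1 h3 with h3 | ⟨l', he', h3⟩
        · exact (hlow b hb l ((List.sublist_cons_self _ _).trans h3) hlen hp).elim
        · obtain ⟨-, rfl⟩ := List.cons_eq_cons.1 he'
          exact (hlow b hb l h3 hlen hp).elim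
      | cons c s₁ =>
        rw [List.cons_append, List.cons_eq_cons] at he
        obtain ⟨rfl, he⟩ := he
        have hx' : x' ∈ B := h2.subset (by simp)
        -- The letter preceding `x'` in the subsequence lies in the sorted block `B` or is `x`; by
        -- `hlow` it cannot lie in `v`.
        have hc : ∀ c l', l = c :: l' → c ≤ x' := by
          rintro c l' rfl
          cases s₁ with
          | nil =>
            rw [List.nil_append] at he
            rw [← he] at h3
            rcases List.sublist_cons_iff.1 h3 with h3 | ⟨l'', he', h3⟩
            · exact (hlow b hb _ h3 hlen hp).elim
            · obtain ⟨rfl, -⟩ := List.cons_eq_cons.1 he'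
              exact (hB x' (List.mem_cons_of_mem b hx')).2
          | cons c' s₁ =>
            rw [List.cons_append, List.cons_eq_cons] at he
            obtain ⟨rfl, he⟩ := he
            have := hP.2.sublist h2
            exact (List.pairwise_cons.1 this).1 c (by simp)
        rw [List.pairwise_cons] at hp
        refine List.pairwise_cons.2 ⟨?_, List.pairwise_cons.2 ⟨?_, hp.2⟩⟩
        · rintro z (_ | ⟨_, hz⟩)
          · exact hP.1 x' hx'
          · exact hp.1 z hz
        · intro z hz
          cases l with
          | nil => simp at hz
          | cons c l =>
            rcases List.mem_cons.1 hz with rfl | hz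
            · exact hc _ _ rfl
            · exact ((List.pairwise_cons.1 hp.2).1 z hz).trans (hc _ _ rfl)

theorem GoodOne.weave_split {k : ℕ} {v : List ℕ} (h : GoodOne k v) :
    weave k (split k v).1 (split k v).2 = v := by
  induction v with
  | nil => rfl
  | cons y v ih =>
    have h1 := ih h.of_cons
    have hP := isPair_split k v
    have hs := tab_split (k := k) le_rfl v
    rw [split]
    split_ifs with hy
    · generalize hm : (split k v).2 = m at *
      generalize hu : (split k v).1 = u at *
      cases u with
      | nil => exact (ENat.natCast_ne_top y (top_le_iff.1 hy)).elim
      | cons x u =>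
        have h2 := hP.filter.tab_weave
        rw [weave] at h1
        set w := weave k u (m.filter fun z : ℕ => !decide ((z : ℕ∞) < tab u 0 k)) with hw
        -- Otherwise goodness, applied with `x` as the middle letter, would make `x` end a weakly
        -- increasing subsequence of length `k + 2`. So `y` belongs to the block right after `x`.
        have hyx : (y : ℕ∞) < tab u 0 k := by
          by_contra! hle
          rw [← h2] at hle
          obtain ⟨l, h3, h4, h5, h6⟩ := (tab_le_iff _ _ _).1 hle
          have h7 : (y :: x :: l).Sublist (y :: v) := by
            refine List.Sublist.cons_cons y ?_
            rw [← h1]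
            exact (h3.cons_cons x).trans (List.sublist_append_right _ _)
          have h8 := h y x l h7 h4 (List.pairwise_cons.2 ⟨h6, h5⟩)
          refine not_le_of_tab_cons_eq_top hP.top ?_
          rw [← h2]
          exact (tab_le_iff _ _ _).2
            ⟨l, h3, h4, h5, (List.pairwise_cons.1 (List.pairwise_cons.1 h8).2).1⟩
        -- Here goodness is applied with `b` as the middle letter: sorted insertion puts `y` at the
        -- end of the block.
        have hB : ∀ b ∈ m.filter (fun z : ℕ => decide ((z : ℕ∞) < tab u 0 k)), b ≤ y := by
          intro b hb
          have h3 : tab (x :: w) 0 k = tab (x :: u) 0 k := by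
            rw [← tab_split le_rfl, hP.split_cons_fst]
            rw [hw, hP.filter.split_weave]
          rw [← h3] at hy
          obtain ⟨l, h3, h4, h5, h6⟩ := (tab_le_iff _ _ _).1 hy
          have h7 : (y :: b :: l).Sublist (y :: v) := by
            refine List.Sublist.cons_cons y ?_
            rw [← h1]
            exact (List.singleton_sublist.2 hb).append h3
          have h8 := h y b l h7 h4 (List.pairwise_cons.2 ⟨h6, h5⟩)
          exact (List.pairwise_cons.1 h8).1 b (by simp)
        have hp := List.perm_orderedInsert (· ≥ ·) y m
        have hsort := hP.pairwise.orderedInsert y m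
        have e1 : (m.orderedInsert (· ≥ ·) y).filter (fun z : ℕ => decide ((z : ℕ∞) < tab u 0 k)) =
            y :: m.filter (fun z : ℕ => decide ((z : ℕ∞) < tab u 0 k)) := by
          refine List.Perm.eq_of_pairwise' (r := (· ≥ ·)) (hsort.filter _)
            (List.pairwise_cons.2 ⟨hB, hP.pairwise.filter _⟩) ?_
          refine (hp.filter _).trans ?_
          rw [List.filter_cons_of_pos (by simpa using hyx)]
        have e2 : (m.orderedInsert (· ≥ ·) y).filter (fun z : ℕ => !decide ((z : ℕ∞) < tab u 0 k)) =
            m.filter (fun z : ℕ => !decide ((z : ℕ∞) < tab u 0 k)) := by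
          refine List.Perm.eq_of_pairwise' (r := (· ≥ ·)) (hsort.filter _)
            (hP.pairwise.filter _) ?_
          refine (hp.filter _).trans ?_
          rw [List.filter_cons_of_neg (by simpa using hyx)]
        rw [weave, e1, e2, ← hw, List.cons_append, h1]
    · have hm : ∀ z ∈ (split k v).2, ¬ (z : ℕ∞) < tab (split k v).1 0 k :=
        fun z hz => (hP.le z hz).not_gt
      rw [weave, List.filter_eq_nil_iff.2 (by simpa using hm), List.filter_eq_self.2
        (by simpa using hm), h1, List.nil_append]

/-- The two kinds of words are equidistributed. -/
noncomputable def goodEquiv (k : ℕ) (p : List ℕ → Prop)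
    (hp : ∀ u v : List ℕ, u.Perm v → (p u ↔ p v)) :
    {v // GoodTwo k v ∧ p v} ≃ {v // GoodOne k v ∧ p v} where
  toFun v := ⟨weave k (split k v.1).1 (split k v.1).2, (isPair_split k v.1).goodOne,
    (hp _ _ ((weave_perm _ _ _).trans (split_perm k v.1))).2 v.2.2⟩
  invFun v := ⟨(split k v.1).2 ++ (split k v.1).1, (isPair_split k v.1).goodTwo,
    (hp _ _ (split_perm k v.1)).2 v.2.2⟩
  left_inv v := by
    refine Subtype.ext ?_
    simp only [(isPair_split k v.1).split_weave]
    exact v.2.1.split_append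
  right_inv v := by
    refine Subtype.ext ?_
    simp only [(isPair_split k v.1).split_append]
    exact v.2.1.weave_split

/-! ### Corners and standard tableaux -/

theorem IsTableau.finite {T : ℕ → ℕ → ℕ∞} (h : IsTableau T) :
    {c : ℕ × ℕ | T c.1 c.2 ≠ ⊤}.Finite := by
  obtain ⟨N, hN⟩ := h.bounded
  refine (Finset.range N ×ˢ Finset.range N).finite_toSet.subset fun c hc => ?_
  simp only [Finset.coe_product, Finset.coe_range, Set.mem_prod, Set.mem_Iio]
  by_contra hlt
  exact hc (hN _ _ (by omega))

theorem IsTableau.le_succ {T : ℕ → ℕ → ℕ∞} (h : IsTableau T) (i j : ℕ) : T i j ≤ T (i + 1) j :=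
  (h.colLT i j).elim le_of_lt fun h => h ▸ le_top

theorem IsTableau.mono {T : ℕ → ℕ → ℕ∞} (h : IsTableau T) {i i' j j' : ℕ} (hi : i ≤ i')
    (hj : j ≤ j') : T i j ≤ T i' j' :=
  (h.monotone i hj).trans (monotone_nat_of_le_succ (f := fun i => T i j') (fun i => h.le_succ i j') hi)

/-- The shape of a tableau. -/
noncomputable def IsTableau.shape {T : ℕ → ℕ → ℕ∞} (h : IsTableau T) : YoungDiagram where
  cells := h.finite.toFinset
  isLowerSet := by
    intro c d hd hc
    simp only [Set.Finite.coe_toFinset] at hc ⊢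
    exact ne_top_of_le_ne_top hc (h.mono hd.1 hd.2)

theorem IsTableau.mem_shape {T : ℕ → ℕ → ℕ∞} (h : IsTableau T) {c : ℕ × ℕ} :
    c ∈ h.shape ↔ T c.1 c.2 ≠ ⊤ := by
  rw [← YoungDiagram.mem_cells]
  simp [IsTableau.shape]

/-- The corners of a Young diagram: the cells that can be removed. -/
abbrev Corner (μ : YoungDiagram) : Type :=
  {c : ℕ × ℕ // c ∈ μ ∧ (c.1 + 1, c.2) ∉ μ ∧ (c.1, c.2 + 1) ∉ μ}

/-- Remove a corner from a Young diagram. -/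
def eraseCorner (μ : YoungDiagram) (c : Corner μ) : YoungDiagram where
  cells := μ.cells.erase c.1
  isLowerSet := by
    intro a b hba ha
    simp only [Finset.coe_erase, Set.mem_sdiff, Set.mem_singleton_iff, SetLike.mem_coe,
      YoungDiagram.mem_cells] at ha ⊢
    refine ⟨μ.isLowerSet hba ha.1, ?_⟩
    rintro rfl
    obtain ⟨h1, h2⟩ := hba
    rcases lt_or_eq_of_le h1 with h1 | h1
    · exact c.2.2.1 (μ.isLowerSet ⟨h1, h2⟩ ha.1)
    · rcases lt_or_eq_of_le h2 with h2 | h2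
      · exact c.2.2.2 (μ.isLowerSet ⟨h1.le, h2⟩ ha.1)
      · exact ha.2 (Prod.ext h1.symm h2.symm)

theorem mem_eraseCorner {μ : YoungDiagram} {c : Corner μ} {a : ℕ × ℕ} :
    a ∈ eraseCorner μ c ↔ a ≠ c.1 ∧ a ∈ μ := by
  rw [← YoungDiagram.mem_cells]
  simp [eraseCorner]

theorem card_eraseCorner (μ : YoungDiagram) (c : Corner μ) :
    (eraseCorner μ c).card + 1 = μ.card :=
  Finset.card_erase_add_one ((YoungDiagram.mem_cells _).2 c.2.1)

/-- The fillings of the cells of `μ` which are standard Young tableaux, extended by `0`. -/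
structure IsStandard (μ : YoungDiagram) (f : ℕ × ℕ → ℕ) : Prop where
  zero : ∀ c, c ∉ μ → f c = 0
  lt : ∀ c ∈ μ, f c < μ.card
  inj : ∀ c ∈ μ, ∀ d ∈ μ, f c = f d → c = d
  row : ∀ c ∈ μ, ∀ d ∈ μ, c.1 = d.1 → c.2 < d.2 → f c < f d
  col : ∀ c ∈ μ, ∀ d ∈ μ, c.2 = d.2 → c.1 < d.1 → f c < f d

open Classical in
theorem nonempty_SYT_equiv (μ : YoungDiagram) : Nonempty (SYT μ ≃ {f // IsStandard μ f}) := by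
  let φ : SYT μ → {f // IsStandard μ f} := fun T =>
    ⟨fun c => if h : c ∈ μ.cells then T.1 ⟨c, h⟩ else 0, by
      constructor
      · intro c hc
        rw [dif_neg (by simpa using hc)]
      · intro c hc
        rw [dif_pos (by simpa using hc)]
        exact Fin.is_lt _
      · intro c hc d hd h
        rw [dif_pos (by simpa using hc), dif_pos (by simpa using hd)] at h
        simpa using T.1.injective (Fin.ext h)
      · intro c hc d hd h h'
        rw [dif_pos (by simpa using hc), dif_pos (by simpa using hd)]
        exact T.2.1 _ _ h h'
      · intro c hc d hd h h'
        rw [dif_pos (by simpa using hc), dif_pos (by simpa using hd)]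
        exact T.2.2 _ _ h h'⟩
  refine ⟨Equiv.ofBijective φ ⟨fun S T h => ?_, fun f => ?_⟩⟩
  · refine Subtype.ext (Equiv.ext fun c => Fin.ext ?_)
    have := congrFun (congrArg Subtype.val h) c.1
    simpa only [φ, dif_pos c.2] using this
  · have hf := f.2
    let e : μ.cells → Fin μ.card := fun c => ⟨f.1 c.1, hf.lt c.1 (by simp)⟩
    have he : Function.Bijective e := by
      rw [Fintype.bijective_iff_injective_and_card]
      refine ⟨fun c d h => Subtype.ext (hf.inj _ (by simp) _ (by simp) ?_), ?_⟩
      · exact congrArg Fin.val h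
      · rw [Fintype.card_coe, Fintype.card_fin]
    refine ⟨⟨Equiv.ofBijective e he, fun c d h h' => ?_, fun c d h h' => ?_⟩, Subtype.ext ?_⟩
    · exact hf.row _ (by simp) _ (by simp) h h'
    · exact hf.col _ (by simp) _ (by simp) h h'
    · funext c
      by_cases hc : c ∈ μ.cells
      · simp only [φ, dif_pos hc]
        rfl
      · simp only [φ, dif_neg hc]
        exact (hf.zero c (by simpa using hc)).symm

theorem IsStandard.update {μ : YoungDiagram} {c : Corner μ} {f : ℕ × ℕ → ℕ}
    (h : IsStandard (eraseCorner μ c) f) :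
    IsStandard μ (Function.update f c.1 (eraseCorner μ c).card) := by
  have hcard := card_eraseCorner μ c
  have hmem : ∀ {d}, d ∈ μ → d ≠ c.1 → d ∈ eraseCorner μ c := fun h h' => mem_eraseCorner.2 ⟨h', h⟩
  constructor
  · intro d hd
    rw [Function.update_of_ne (by rintro rfl; exact hd c.2.1)]
    exact h.zero d fun h' => hd (mem_eraseCorner.1 h').2
  · intro d hd
    rcases eq_or_ne d c.1 with rfl | hdc
    · rw [Function.update_self]
      omega
    · rw [Function.update_of_ne hdc]
      have := h.lt d (hmem hd hdc)
      omega
  · intro d hd e he hde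
    rcases eq_or_ne d c.1 with h1 | h1 <;> rcases eq_or_ne e c.1 with h2 | h2
    · rw [h1, h2]
    · rw [h1, Function.update_self, Function.update_of_ne h2] at hde
      exact ((h.lt e (hmem he h2)).ne' hde).elim
    · rw [h2, Function.update_self, Function.update_of_ne h1] at hde
      exact ((h.lt d (hmem hd h1)).ne hde).elim
    · rw [Function.update_of_ne h1, Function.update_of_ne h2] at hde
      exact h.inj d (hmem hd h1) e (hmem he h2) hde
  · intro d hd e he h3 h4
    have h1 : d ≠ c.1 := by
      rintro rfl
      exact c.2.2.2 (μ.isLowerSet (show (c.1.1, c.1.2 + 1) ≤ e from ⟨h3.le, h4⟩) he)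
    rw [Function.update_of_ne h1]
    rcases eq_or_ne e c.1 with rfl | h2
    · rw [Function.update_self]
      exact h.lt d (hmem hd h1)
    · rw [Function.update_of_ne h2]
      exact h.row d (hmem hd h1) e (hmem he h2) h3 h4
  · intro d hd e he h3 h4
    have h1 : d ≠ c.1 := by
      rintro rfl
      exact c.2.2.1 (μ.isLowerSet (show (c.1.1 + 1, c.1.2) ≤ e from ⟨h4, h3.le⟩) he)
    rw [Function.update_of_ne h1]
    rcases eq_or_ne e c.1 with rfl | h2
    · rw [Function.update_self]
      exact h.lt d (hmem hd h1)
    · rw [Function.update_of_ne h2]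
      exact h.col d (hmem hd h1) e (hmem he h2) h3 h4

/-- The largest entry of a standard tableau sits in a corner. -/
theorem IsStandard.exists_update {μ : YoungDiagram} {f : ℕ × ℕ → ℕ} (h : IsStandard μ f)
    (hμ : μ.card ≠ 0) : ∃ (c : Corner μ) (g : ℕ × ℕ → ℕ), IsStandard (eraseCorner μ c) g ∧
      Function.update g c.1 (eraseCorner μ c).card = f := by
  obtain ⟨c, hc, hfc⟩ : ∃ c ∈ μ, f c + 1 = μ.card := by
    have h1 : μ.cells.image f = Finset.range μ.card := by
      apply Finset.eq_of_subset_of_card_le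
      · intro x hx
        obtain ⟨c, hc, rfl⟩ := Finset.mem_image.1 hx
        exact Finset.mem_range.2 (h.lt c (by simpa using hc))
      · rw [Finset.card_range, Finset.card_image_of_injOn]
        intro c hc d hd
        exact h.inj c (by simpa using hc) d (by simpa using hd)
    have h2 : μ.card - 1 ∈ μ.cells.image f := by
      rw [h1, Finset.mem_range]
      omega
    obtain ⟨c, hc, h3⟩ := Finset.mem_image.1 h2
    exact ⟨c, by simpa using hc, by omega⟩
  let C : Corner μ := ⟨c, hc, fun h1 => by
      have := h.col c hc _ h1 rfl (Nat.lt_succ_self _)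
      have := h.lt _ h1
      omega, fun h1 => by
      have := h.row c hc _ h1 rfl (Nat.lt_succ_self _)
      have := h.lt _ h1
      omega⟩
  have hcard := card_eraseCorner μ C
  have hmem : ∀ {d}, d ∈ eraseCorner μ C → d ≠ c ∧ d ∈ μ := mem_eraseCorner.1
  -- The removed cell is reset to `0`, the default value outside the shape.
  refine ⟨C, Function.update f c 0, ?_, ?_⟩
  · constructor
    · intro d hd
      rcases eq_or_ne d c with rfl | hdc
      · rw [Function.update_self]
      · rw [Function.update_of_ne hdc]
        exact h.zero d fun h1 => hd (mem_eraseCorner.2 ⟨hdc, h1⟩)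
    · intro d hd
      obtain ⟨h1, h2⟩ := hmem hd
      rw [Function.update_of_ne h1]
      have h3 := h.lt d h2
      have h4 : f d ≠ f c := fun h4 => h1 (h.inj d h2 c hc h4)
      omega
    · intro d hd e he
      rw [Function.update_of_ne (hmem hd).1, Function.update_of_ne (hmem he).1]
      exact h.inj d (hmem hd).2 e (hmem he).2
    · intro d hd e he
      rw [Function.update_of_ne (hmem hd).1, Function.update_of_ne (hmem he).1]
      exact h.row d (hmem hd).2 e (hmem he).2
    · intro d hd e he
      rw [Function.update_of_ne (hmem hd).1, Function.update_of_ne (hmem he).1]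
      exact h.col d (hmem hd).2 e (hmem he).2
  · rw [Function.update_idem]
    conv_rhs => rw [← Function.update_eq_self c f]
    exact congrArg _ (by omega)

theorem nonempty_isStandard_equiv (μ : YoungDiagram) (hμ : μ.card ≠ 0) :
    Nonempty ((Σ c : Corner μ, {f // IsStandard (eraseCorner μ c) f}) ≃ {f // IsStandard μ f}) := by
  let φ : (Σ c : Corner μ, {f // IsStandard (eraseCorner μ c) f}) → {f // IsStandard μ f} :=
    fun p => ⟨_, p.2.2.update⟩
  refine ⟨Equiv.ofBijective φ ⟨?_, fun f => ?_⟩⟩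
  · rintro ⟨c, f, hf⟩ ⟨d, g, hg⟩ h
    replace h : Function.update f c.1 (eraseCorner μ c).card =
      Function.update g d.1 (eraseCorner μ d).card := congrArg Subtype.val h
    have h1 := card_eraseCorner μ c
    have h2 := card_eraseCorner μ d
    obtain rfl : c = d := by
      by_contra hcd
      have hne : c.1 ≠ d.1 := fun h => hcd (Subtype.ext h)
      have h3 := congrFun h c.1
      rw [Function.update_self, Function.update_of_ne hne] at h3
      have := hg.lt c.1 (mem_eraseCorner.2 ⟨hne, c.2.1⟩)
      omega
    have : f = g := by
      funext a
      rcases eq_or_ne a c.1 with rfl | ha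
      · rw [hf.zero _ fun h => (mem_eraseCorner.1 h).1 rfl,
          hg.zero _ fun h => (mem_eraseCorner.1 h).1 rfl]
      · simpa [ha] using congrFun h a
    subst this
    rfl
  · obtain ⟨c, g, hg, h⟩ := f.2.exists_update hμ
    exact ⟨⟨c, g, hg⟩, Subtype.ext h⟩

theorem Inserts.exists_corner {i : ℕ} {U T : ℕ → ℕ → ℕ∞} {x : ℕ∞} (hU : IsTableau U)
    (hT : IsTableau T) (h : Inserts i U x T) :
    ∃ c : Corner hT.shape, c.1.1 = i ∧ hU.shape = eraseCorner hT.shape c := by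
  obtain ⟨j, hj, hs⟩ := h.shape
  have h1 : U (i + 1) j = ⊤ := top_le_iff.1 (hj ▸ hU.le_succ i j)
  have h2 : U i (j + 1) = ⊤ := top_le_iff.1 (hj ▸ hU.monotone i (Nat.le_succ j))
  refine ⟨⟨(i, j), ?_, ?_, ?_⟩, rfl, ?_⟩
  · rw [hT.mem_shape, Ne, hs]
    simp
  · rw [hT.mem_shape, Ne, hs]
    simp [h1]
  · rw [hT.mem_shape, Ne, hs]
    simp [h2]
  · refine YoungDiagram.ext (Finset.ext fun c => ?_)
    rw [YoungDiagram.mem_cells, YoungDiagram.mem_cells, mem_eraseCorner, hU.mem_shape]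
    dsimp only
    rw [hT.mem_shape, Ne, Ne, Ne, hs, Prod.ext_iff]
    constructor
    · intro h
      refine ⟨?_, fun h' => h h'.1⟩
      rintro ⟨h3, h4⟩
      rw [h3, h4] at h
      exact h hj
    · rintro ⟨h, h'⟩ h3
      exact h' ⟨h3, h⟩

/-- Robinson–Schensted: removing the last letter of a word corresponds to removing a corner of `T`,
and each corner determines the letter and the previous tableau. Standard tableaux satisfy the same
recursion. -/
theorem nonempty_tab_equiv {T : ℕ → ℕ → ℕ∞} (hT : IsTableau T) :
    Nonempty ({v // tab v = T} ≃ {f // IsStandard hT.shape f}) := by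
  induction hn : hT.shape.card generalizing T with
  | zero =>
    have h0 : ∀ c, c ∉ hT.shape := by
      intro c hc
      rw [← YoungDiagram.mem_cells, Finset.card_eq_zero.1 hn] at hc
      simp at hc
    have h1 : T = fun _ _ => ⊤ := by
      funext i j
      by_contra h
      exact h0 (i, j) (hT.mem_shape.2 h)
    refine ⟨Equiv.ofBijective (fun _ => ⟨fun _ => 0, ?_⟩) ⟨?_, ?_⟩⟩
    · exact ⟨fun _ _ => rfl, fun c hc => (h0 c hc).elim, fun c hc => (h0 c hc).elim,
        fun c hc => (h0 c hc).elim, fun c hc => (h0 c hc).elim⟩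
    · have key : ∀ v : List ℕ, tab v = T → v = [] := by
        intro v hv
        cases v with
        | nil => rfl
        | cons x u =>
          obtain ⟨y, hy⟩ := exists_bumpsTo_tab x u
          obtain ⟨j, hj⟩ := hy.exists_eq
          rw [hv, h1] at hj
          exact (hy.ne_top hj.symm).elim
      exact fun u v _ => Subtype.ext ((key _ u.2).trans (key _ v.2).symm)
    · intro f
      refine ⟨⟨[], h1.symm⟩, Subtype.ext (funext fun c => (f.2.zero c (h0 c)).symm)⟩
  | succ n ih =>
    have hex : ∀ c : Corner hT.shape, ∃ (U : ℕ → ℕ → ℕ∞) (x : ℕ), IsTableau U ∧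
        Inserts c.1.1 U x T := by
      intro c
      have h2 := c.2.2.1
      have h3 := c.2.2.2
      rw [hT.mem_shape, not_not] at h2 h3
      obtain ⟨U, x, hU, hI⟩ := hT.exists_uninsert (hT.mem_shape.1 c.2.1) h3 h2
      obtain ⟨y, hy⟩ := hI.bumpsTo
      obtain ⟨x, rfl⟩ := ENat.ne_top_iff_exists.1 hy.ne_top
      exact ⟨U, x, hU, hI⟩
    choose U x hU hI using hex
    have corner_ext : ∀ c d : Corner hT.shape, c.1.1 = d.1.1 → c = d := by
      intro c d h
      refine Subtype.ext (Prod.ext h ?_)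
      have h1 := c.2
      have h2 := d.2
      rw [← h] at h2
      rcases lt_trichotomy c.1.2 d.1.2 with h3 | h3 | h3
      · exact (h1.2.2 (hT.shape.isLowerSet (show (c.1.1, c.1.2 + 1) ≤ d.1 from ⟨h.le, h3⟩) h2.1)).elim
      · exact h3
      · exact (h2.2.2 (hT.shape.isLowerSet (show (c.1.1, d.1.2 + 1) ≤ c.1 from ⟨le_rfl, h3⟩) h1.1)).elim
    have hshape : ∀ c, (hU c).shape = eraseCorner hT.shape c := by
      intro c
      obtain ⟨d, hd, h⟩ := (hI c).exists_corner (hU c) hT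
      rwa [corner_ext d c hd] at h
    have e1 : ∀ c, Nonempty ({u // tab u = U c} ≃ {f // IsStandard (eraseCorner hT.shape c) f}) := by
      intro c
      rw [← hshape]
      refine ih (hU c) ?_
      have := card_eraseCorner hT.shape c
      rw [hshape]
      omega
    obtain ⟨e2⟩ := nonempty_isStandard_equiv hT.shape (by omega)
    have e3 : Function.Bijective (fun p : Σ c, {u // tab u = U c} =>
        (⟨x p.1 :: p.2.1, by
          rw [tab, p.2.2, (hI p.1).rowInsert_eq (hU p.1).monotone]⟩ : {v // tab v = T})) := by
      constructor
      · rintro ⟨c, u, hu⟩ ⟨d, w, hw⟩ h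
        obtain ⟨-, rfl⟩ := List.cons_eq_cons.1 (congrArg Subtype.val h)
        -- The remaining word determines its tableau, hence the smaller shape and the removed
        -- corner.
        obtain rfl : c = d := by
          by_contra hcd
          have h1 := hshape c
          have h2 := hshape d
          have h3 : (hU c).shape = (hU d).shape := by
            congr 1
            exact hu.symm.trans hw
          rw [h1, h2] at h3
          have h4 : c.1 ∈ eraseCorner hT.shape d :=
            mem_eraseCorner.2 ⟨fun h => hcd (Subtype.ext h), c.2.1⟩
          rw [← h3] at h4
          exact (mem_eraseCorner.1 h4).1 rfl
        rfl
      · rintro ⟨v, hv⟩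
        cases v with
        | nil =>
          have h1 : (0 : ℕ) < hT.shape.card := by omega
          obtain ⟨c, hc⟩ := Finset.card_pos.1 h1
          rw [YoungDiagram.mem_cells, hT.mem_shape, ← hv] at hc
          exact (hc rfl).elim
        | cons y u =>
          obtain ⟨i, hi⟩ := exists_inserts_tab y u
          rw [hv] at hi
          obtain ⟨c, rfl, -⟩ := hi.exists_corner (isTableau_tab u) hT
          obtain ⟨h1, h2⟩ := hi.unique (isTableau_tab u).monotone (hU c).monotone (hI c)
          obtain rfl : y = x c := by exact_mod_cast h2
          exact ⟨⟨c, u, h1⟩, rfl⟩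
    exact ⟨(Equiv.ofBijective _ e3).symm.trans
      ((Equiv.sigmaCongrRight fun c => (e1 c).some).trans e2)⟩

/-! ### Insertion tableaux of good words -/

/-- Delete the entries of the first row in the columns from `k` on. -/
noncomputable def capTab (k : ℕ) (T : ℕ → ℕ → ℕ∞) : ℕ → ℕ → ℕ∞ := fun i j =>
  if i = 0 ∧ k ≤ j then ⊤ else T i j

theorem GoodTwo.le_head {k y : ℕ} {u l : List ℕ} (h : GoodTwo k (y :: u)) (hl : l.Sublist (y :: u))
    (hlen : l.length = k + 2) (hp : l.Pairwise (· ≥ ·)) : ∀ z ∈ l, z ≤ y := by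
  intro z hz
  rcases List.sublist_cons_iff.1 hl with hl | ⟨l', rfl, hl⟩
  · exact (List.pairwise_cons.1 (h y l (hl.cons_cons y) hlen hp)).1 z hz
  · rcases List.mem_cons.1 hz with rfl | hz
    · exact le_rfl
    · exact (List.pairwise_cons.1 hp).1 z hz

theorem GoodTwo.tab_le {k y j : ℕ} {u : List ℕ} (h : GoodTwo k (y :: u)) (hj : k + 1 ≤ j)
    (ht : tab u 0 j ≠ ⊤) : tab u 0 j ≤ y := by
  obtain ⟨x, hx⟩ := ENat.ne_top_iff_exists.1 ht
  obtain ⟨l, h1, h2, h3, -⟩ := (tab_le_iff u j x).1 hx.ge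
  refine (tab_le_iff u j y).2 ⟨l, h1, h2, h3, fun z hz => ?_⟩
  -- Lists are reversed, so `take` keeps the latest letters, among them the largest.
  have h4 := h.le_head (l := l.take (k + 2)) (((List.take_sublist _ _).trans h1).cons y)
    (by rw [List.length_take]; omega) (h3.sublist (List.take_sublist _ _))
  cases l with
  | nil => simp at hz
  | cons c l =>
    have h5 := h4 c (by simp)
    rcases List.mem_cons.1 hz with rfl | hz
    · exact h5
    · exact ((List.pairwise_cons.1 h3).1 z hz).trans h5

/-- By `GoodTwo.tab_le`, `y` is at least every entry in the columns from `k + 1` on. If it bumped a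
finite entry, that entry would lie among these or be at most one of them, which is impossible. -/
theorem GoodTwo.inserts_zero {k y : ℕ} {u : List ℕ} (h : GoodTwo k (y :: u))
    (ht : tab (y :: u) 0 (k + 1) ≠ ⊤) : Inserts 0 (tab u) y (tab (y :: u)) := by
  obtain ⟨i, hi⟩ := exists_inserts_tab y u
  cases i with
  | zero => exact hi
  | succ i =>
    obtain ⟨z, hz, hb, -⟩ := hi
    have hr := mt (hb.eq_top_iff hz (k + 1)).2 ht
    obtain ⟨p, hp, hlt, he, rfl⟩ := hb
    exfalso
    rcases le_or_gt (k + 1) p with hkp | hkp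
    · exact (h.tab_le hkp hz).not_gt hp
    · exact (h.tab_le le_rfl hr).not_gt (hp.trans_le ((isTableau_tab u).monotone 0 hkp.le))

theorem GoodTwo.tab_one_eq_top {k : ℕ} {v : List ℕ} (h : GoodTwo k v) : tab v 1 (k + 1) = ⊤ := by
  induction v with
  | nil => rfl
  | cons y u ih =>
    by_cases ht : tab (y :: u) 0 (k + 1) = ⊤
    · exact top_le_iff.1 (ht ▸ (isTableau_tab (y :: u)).le_succ 0 (k + 1))
    · rw [(h.inserts_zero ht).2 0]
      exact ih h.of_cons

theorem goodTwo_of_tab_eq_top {k : ℕ} {v : List ℕ} (h : tab v 0 (k + 1) = ⊤) : GoodTwo k v :=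
  fun y l hl hlen hp =>
    ((tab_eq_top_iff v (k + 1)).1 h l ((List.sublist_cons_self y l).trans hl) hlen hp).elim

theorem capTab_eq_self {k : ℕ} {T : ℕ → ℕ → ℕ∞} (hT : IsTableau T) (h : T 0 k = ⊤) :
    capTab k T = T := by
  funext i j
  unfold capTab
  split_ifs with hij
  · rw [hij.1]
    exact (top_le_iff.1 (h ▸ hT.monotone 0 hij.2)).symm
  · rfl

/-- Induction on a bound for the number of first-row cells in the columns from `k + 1` on. Each such
cell accounts for one forced last letter; without them goodness is automatic. -/
theorem nonempty_goodTwo_equiv {k : ℕ} {T : ℕ → ℕ → ℕ∞} (hT : IsTableau T)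
    (h1 : T 1 (k + 1) = ⊤) :
    Nonempty ({v // GoodTwo k v ∧ tab v = T} ≃ {u // tab u = capTab (k + 1) T}) := by
  obtain ⟨N, hN⟩ := hT.bounded
  replace hN : T 0 (k + 1 + N) = ⊤ := hN _ _ (by omega)
  induction N generalizing T with
  | zero =>
    rw [capTab_eq_self hT hN]
    refine ⟨Equiv.subtypeEquivRight fun v => ⟨And.right, fun h => ⟨?_, h⟩⟩⟩
    exact goodTwo_of_tab_eq_top (h ▸ hN)
  | succ N ih =>
    by_cases h0 : T 0 (k + 1 + N) = ⊤
    · exact ih hT h1 h0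
    have hc : T 1 (k + 1 + N) = ⊤ := top_le_iff.1 (h1 ▸ hT.monotone 1 (by omega))
    obtain ⟨U, x, hU, hI⟩ := hT.exists_uninsert h0 hN hc
    obtain ⟨p, hp, hs⟩ := hI.shape
    obtain rfl : p = k + 1 + N := by
      by_contra hne
      have h2 := mt (hs 0 (k + 1 + N)).2 h0
      have h3 : U 0 (k + 1 + N) ≠ ⊤ := fun h => h2 ⟨h, fun h => hne h.2.symm⟩
      have h4 : T 0 p = ⊤ := by
        refine top_le_iff.1 (hN ▸ hT.monotone 0 ?_)
        by_contra hlt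
        exact h3 (top_le_iff.1 (hp ▸ hU.monotone 0 (by omega)))
      exact ((hs 0 p).1 h4).2 ⟨rfl, rfl⟩
    have hx : x ≠ ⊤ := hI.1.ne_top
    obtain ⟨x, rfl⟩ := ENat.ne_top_iff_exists.1 hx
    have hcap : capTab (k + 1) U = capTab (k + 1) T := by
      obtain ⟨⟨q, hq, -, he, hq'⟩, h2⟩ := hI
      funext i j
      unfold capTab
      split_ifs with hij
      · rfl
      · cases i with
        | zero =>
          rw [he, Function.update_of_ne]
          rintro rfl
          have h3 : T 0 j ≠ ⊤ := by
            rw [he, Function.update_self]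
            exact hx
          exact h3 ((hs 0 j).2 ⟨hq'.symm, by omega⟩)
        | succ i => rw [h2]
    have e := ih hU (hI.2 0 ▸ h1) hp
    rw [hcap] at e
    obtain ⟨e⟩ := e
    -- The last letter of `u` is in the first row of `U`, left of the new cell, so it is at most
    -- `x`; by goodness of `u` it bounds every long increasing subsequence.
    have hgood : ∀ u, GoodTwo k u → tab u = U → GoodTwo k (x :: u) := by
      rintro u hu rfl
      refine hu.cons fun l hl hlen hl' => List.pairwise_cons.2 ⟨fun z hz => ?_, hl'⟩
      cases u with
      | nil => simp [List.sublist_nil.1 hl] at hlen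
      | cons y u =>
        refine (hu.le_head hl hlen hl' z hz).trans ?_
        obtain ⟨o, ho⟩ := exists_bumpsTo_tab y u
        obtain ⟨j, hj⟩ := ho.exists_eq
        obtain ⟨q, -, hlt, -, hq⟩ := hI.1
        have hjq : j < q := by
          by_contra hle
          have := hU.monotone 0 (not_lt.1 hle)
          rw [← hq, hj] at this
          exact ENat.natCast_ne_top y (top_le_iff.1 this)
        have := hlt j hjq
        rw [hj] at this
        exact_mod_cast this
    refine ⟨(Equiv.ofBijective (fun u : {u // GoodTwo k u ∧ tab u = U} =>
      (⟨x :: u.1, hgood _ u.2.1 u.2.2, by rw [tab, u.2.2, hI.rowInsert_eq hU.monotone]⟩ :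
        {v // GoodTwo k v ∧ tab v = T})) ⟨?_, ?_⟩).symm.trans e⟩
    · intro u w h
      exact Subtype.ext (List.cons_eq_cons.1 (congrArg Subtype.val h)).2
    · rintro ⟨v, hv, hvT⟩
      cases v with
      | nil =>
        rw [← hvT] at h0
        exact (h0 rfl).elim
      | cons y u =>
        have h2 : tab (y :: u) 0 (k + 1) ≠ ⊤ := by
          rw [hvT]
          exact ne_top_of_le_ne_top h0 (hT.monotone 0 (by omega))
        have h3 := hv.inserts_zero h2
        rw [hvT] at h3
        obtain ⟨h4, h5⟩ := h3.unique (isTableau_tab u).monotone hU.monotone hI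
        obtain rfl : y = x := by exact_mod_cast h5
        exact ⟨⟨u, hv.of_cons, h4⟩, rfl⟩

theorem IsTableau.capTab {k : ℕ} {T : ℕ → ℕ → ℕ∞} (hT : IsTableau T) (h : T 1 k = ⊤) :
    IsTableau (capTab k T) := by
  refine ⟨fun i a b hab => ?_, fun i j => ?_, ?_⟩
  · unfold PatternQSym.capTab
    split_ifs with h1 h2
    · exact le_rfl
    · omega
    · exact le_top
    · exact hT.monotone i hab
  · unfold PatternQSym.capTab
    rw [if_neg (by omega : ¬ (i + 1 = 0 ∧ k ≤ j))]
    split_ifs with h1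
    · obtain ⟨rfl, h1⟩ := h1
      exact Or.inr (top_le_iff.1 (h ▸ hT.monotone 1 h1))
    · exact hT.colLT i j
  · obtain ⟨N, hN⟩ := hT.bounded
    refine ⟨N, fun i j hij => ?_⟩
    unfold PatternQSym.capTab
    rw [hN i j hij, ite_self]

/-! ### Semistandard tableaux as fillings, and their content -/

/-- The filling of a semistandard tableau, with the entry `⊤` outside of the shape. -/
noncomputable def toTab {μ : YoungDiagram} (T : SemistandardYoungTableau μ) : ℕ → ℕ → ℕ∞ :=
  open Classical in fun i j => if (i, j) ∈ μ then (T i j : ℕ∞) else ⊤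

theorem toTab_ne_top {μ : YoungDiagram} {T : SemistandardYoungTableau μ} {i j : ℕ} :
    toTab T i j ≠ ⊤ ↔ (i, j) ∈ μ := by
  unfold toTab
  split_ifs with h <;> simp [h]

theorem isTableau_toTab {μ : YoungDiagram} (T : SemistandardYoungTableau μ) :
    IsTableau (toTab T) := by
  refine ⟨fun i a b hab => ?_, fun i j => ?_, ?_⟩
  · unfold toTab
    split_ifs with h1 h2 h2
    · exact_mod_cast T.row_weak_of_le hab h2
    · exact le_top
    · exact (h1 (μ.up_left_mem le_rfl hab h2)).elim
    · exact le_rfl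
  · unfold toTab
    split_ifs with h1 h2 h2
    · exact Or.inl (by exact_mod_cast T.col_strict (Nat.lt_succ_self i) h2)
    · exact Or.inr rfl
    · exact (h1 (μ.up_left_mem (Nat.le_succ i) le_rfl h2)).elim
    · exact Or.inr rfl
  · refine ⟨μ.cells.sup Prod.fst + μ.cells.sup Prod.snd + 1, fun i j hij => ?_⟩
    by_contra h
    have h1 := (YoungDiagram.mem_cells _).2 (toTab_ne_top.1 h)
    have h2 := Finset.le_sup (f := Prod.fst) h1
    have h3 := Finset.le_sup (f := Prod.snd) h1
    dsimp only at h2 h3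
    omega

theorem shape_toTab {μ : YoungDiagram} (T : SemistandardYoungTableau μ) :
    (isTableau_toTab T).shape = μ := by
  refine YoungDiagram.ext (Finset.ext fun c => ?_)
  rw [YoungDiagram.mem_cells, YoungDiagram.mem_cells, IsTableau.mem_shape, toTab_ne_top]

theorem toTab_injective {μ : YoungDiagram} : Function.Injective (toTab (μ := μ)) := by
  intro S T h
  refine SemistandardYoungTableau.ext fun i j => ?_
  by_cases hij : (i, j) ∈ μ
  · have := congrFun (congrFun h i) j
    unfold toTab at this
    rw [if_pos hij, if_pos hij] at this
    exact_mod_cast this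
  · rw [S.zeros hij, T.zeros hij]

theorem IsTableau.exists_toTab {T : ℕ → ℕ → ℕ∞} (hT : IsTableau T) :
    ∃ S : SemistandardYoungTableau hT.shape, toTab S = T := by
  have key : ∀ {i j}, (i, j) ∈ hT.shape → ((T i j).toNat : ℕ∞) = T i j :=
    fun h => ENat.natCast_toNat (hT.mem_shape.1 h)
  refine ⟨⟨fun i j => (T i j).toNat, ?_, ?_, ?_⟩, ?_⟩
  · intro i j₁ j₂ hj h
    have h' := hT.shape.up_left_mem le_rfl hj.le h
    have := hT.monotone i hj.le
    rw [← key h, ← key h'] at this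
    exact_mod_cast this
  · intro i₁ i₂ j hi h
    have h' := hT.shape.up_left_mem hi.le le_rfl h
    have h'' := hT.shape.up_left_mem (Nat.succ_le_of_lt hi) le_rfl h
    have := ((hT.colLT i₁ j).resolve_right (hT.mem_shape.1 h'')).trans_le
      (hT.mono (Nat.succ_le_of_lt hi) le_rfl)
    rw [← key h, ← key h'] at this
    exact_mod_cast this
  · intro i j h
    rw [hT.mem_shape, not_not] at h
    simp only at h
    rw [h]
    rfl
  · funext i j
    unfold toTab
    split_ifs with h
    · exact key h
    · rw [hT.mem_shape, not_not] at h
      exact h.symm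

theorem sum_tab {M : Type*} [AddCommMonoid M] {f : ℕ∞ → M} (hf : f ⊤ = 0) (v : List ℕ) {N : ℕ}
    (hN : ∀ i j, N ≤ i ∨ N ≤ j → tab v i j = ⊤) :
    ∑ i ∈ Finset.range N, ∑ j ∈ Finset.range N, f (tab v i j) =
      (v.map fun x : ℕ => f x).sum := by
  induction v with
  | nil => simp [tab, hf]
  | cons y u ih =>
    obtain ⟨i, hi⟩ := exists_inserts_tab y u
    rw [hi.sum_eq hf hN, ih, List.map_cons, List.sum_cons, add_comm]
    intro a b hab
    exact top_le_iff.1 (hN a b hab ▸ hi.le a b)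

theorem sum_cells_of_tab_eq {M : Type*} [AddCommMonoid M] (g : ℕ → M) {v : List ℕ}
    {μ : YoungDiagram} {T : SemistandardYoungTableau μ} (h : tab v = toTab T) :
    (v.map g).sum = ∑ c ∈ μ.cells, g (T c.1 c.2) := by
  obtain ⟨N, hN⟩ := (isTableau_tab v).bounded
  let f : ℕ∞ → M := fun x => if x = ⊤ then 0 else g x.toNat
  have h1 := sum_tab (f := f) (if_pos rfl) v hN
  have h2 : (v.map fun x : ℕ => f x) = v.map g := by simp [f]
  rw [h2, h, ← Finset.sum_product'] at h1
  rw [← h1]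
  symm
  refine Finset.sum_subset_zero_on_sdiff ?_ ?_ ?_
  · intro c hc
    have hc' := toTab_ne_top (T := T).2 ((YoungDiagram.mem_cells _).1 hc)
    rw [Finset.mem_product, Finset.mem_range, Finset.mem_range]
    by_contra hlt
    rw [← h] at hc'
    exact hc' (hN c.1 c.2 (by omega))
  · intro c hc
    rw [Finset.mem_sdiff, YoungDiagram.mem_cells] at hc
    exact if_pos (by_contra fun h => hc.2 (toTab_ne_top.1 h))
  · intro c hc
    have hc' := (YoungDiagram.mem_cells _).1 hc
    have : toTab T c.1 c.2 = (T c.1 c.2 : ℕ) := if_pos hc'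
    simp [f, this]

/-! ### Counting good words by their insertion tableaux -/

/-- The exponent vector of the monomial of a word. -/
noncomputable def weight (v : List ℕ) : ℕ →₀ ℕ := (v.map fun x => Finsupp.single x 1).sum

theorem weight_perm {u v : List ℕ} (h : u.Perm v) : weight u = weight v :=
  (h.map _).sum_eq

theorem mem_fattenedHooks {n k : ℕ} {μ : YoungDiagram} :
    μ ∈ fattenedHooks n (k + 1) ↔ μ.card = n ∧ (1, k) ∉ μ := by
  simp only [fattenedHooks, Finset.mem_filter, Set.Finite.mem_toFinset, Set.mem_ofPred_eq]
  refine and_congr_right fun _ => ⟨fun h h' => h _ h' rfl, ?_⟩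
  rintro h ⟨i, j⟩ hc he
  rw [Prod.mk.injEq] at he
  obtain ⟨rfl, rfl⟩ : i = 1 ∧ j = k := by omega
  exact h hc

theorem shape_capTab {n k : ℕ} (μ : fattenedHooks n (k + 1)) (T : SemistandardYoungTableau μ.1)
    (h : toTab T 1 k = ⊤) : ((isTableau_toTab T).capTab h).shape = capFirstRow μ := by
  refine YoungDiagram.ext (Finset.ext fun c => ?_)
  have h1 : c ∈ (capFirstRow μ).cells ↔ c ∈ μ.1 ∧ (c.1 = 0 → c.2 < k) := by
    simp [capFirstRow]
  rw [YoungDiagram.mem_cells, IsTableau.mem_shape, h1, ← toTab_ne_top (T := T)]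
  unfold capTab
  split_ifs with h2
  · simp only [ne_eq, not_true_eq_false, false_iff, not_and, Classical.not_imp, not_lt]
    exact fun _ => h2
  · exact ⟨fun h3 => ⟨h3, fun h4 => not_le.1 fun h5 => h2 ⟨h4, h5⟩⟩, And.left⟩

/-- The entries are confined to the support of `d`. Finiteness matters because `Nat.card` of an
infinite type is `0`. -/
theorem finite_tableaux (μ : YoungDiagram) (d : ℕ →₀ ℕ) :
    Finite {T : SemistandardYoungTableau μ //
      ∑ c ∈ μ.cells, Finsupp.single (T c.1 c.2) 1 = d} := by
  have hd : ∀ (T : {T : SemistandardYoungTableau μ //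
      ∑ c ∈ μ.cells, Finsupp.single (T c.1 c.2) 1 = d}) (c : μ.cells),
      T.1 c.1.1 c.1.2 ∈ d.support := by
    rintro ⟨T, hT⟩ c
    change T c.1.1 c.1.2 ∈ d.support
    rw [Finsupp.mem_support_iff, ← hT, Finsupp.finsetSum_apply]
    intro h0
    have := Finset.sum_eq_zero_iff.1 h0 c.1 c.2
    simp at this
  refine Finite.of_injective (β := μ.cells → d.support) (fun T c => ⟨_, hd T c⟩) ?_
  intro S T h
  refine Subtype.ext (SemistandardYoungTableau.ext fun i j => ?_)
  by_cases hij : (i, j) ∈ μ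
  · exact congrArg Subtype.val (congrFun h ⟨(i, j), (YoungDiagram.mem_cells _).2 hij⟩)
  · rw [S.1.zeros hij, T.1.zeros hij]

theorem card_goodTwo (k n : ℕ) (d : ℕ →₀ ℕ) :
    Nat.card {v // GoodTwo k v ∧ v.length = n ∧ weight v = d} =
      ∑ μ : fattenedHooks n (k + 1 + 1), numSYT (capFirstRow μ) *
        Nat.card {T : SemistandardYoungTableau μ.1 //
          ∑ c ∈ μ.1.cells, Finsupp.single (T c.1 c.2) 1 = d} := by
  have htop : ∀ (μ : fattenedHooks n (k + 1 + 1)) (T : SemistandardYoungTableau μ.1),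
      toTab T 1 (k + 1) = ⊤ :=
    fun μ T => by_contra fun h => (mem_fattenedHooks.1 μ.2).2 (toTab_ne_top.1 h)
  have hiff : ∀ (μ : fattenedHooks n (k + 1 + 1)) (T : {T : SemistandardYoungTableau μ.1 //
      ∑ c ∈ μ.1.cells, Finsupp.single (T c.1 c.2) 1 = d}) (v : List ℕ), tab v = toTab T.1 →
      v.length = n ∧ weight v = d := by
    intro μ T v h
    constructor
    · have := sum_cells_of_tab_eq (fun _ => 1) h
      simp only [List.map_const', List.sum_replicate, smul_eq_mul, mul_one, Finset.sum_const] at this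
      exact this.trans (mem_fattenedHooks.1 μ.2).1
    · exact (sum_cells_of_tab_eq _ h).trans T.2
  have e1 : ∀ (μ : fattenedHooks n (k + 1 + 1)) (T : {T : SemistandardYoungTableau μ.1 //
      ∑ c ∈ μ.1.cells, Finsupp.single (T c.1 c.2) 1 = d}),
      Nonempty (SYT (capFirstRow μ) ≃ {v // GoodTwo k v ∧ tab v = toTab T.1}) := by
    intro μ T
    obtain ⟨f⟩ := nonempty_goodTwo_equiv (isTableau_toTab T.1) (htop μ T.1)
    obtain ⟨g⟩ := nonempty_tab_equiv ((isTableau_toTab T.1).capTab (htop μ T.1))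
    rw [shape_capTab μ T.1 (htop μ T.1)] at g
    obtain ⟨h⟩ := nonempty_SYT_equiv (capFirstRow μ)
    exact ⟨h.trans (g.symm.trans f.symm)⟩
  let φ : (Σ μ : fattenedHooks n (k + 1 + 1), Σ T : {T : SemistandardYoungTableau μ.1 //
      ∑ c ∈ μ.1.cells, Finsupp.single (T c.1 c.2) 1 = d},
      {v // GoodTwo k v ∧ tab v = toTab T.1}) →
      {v // GoodTwo k v ∧ v.length = n ∧ weight v = d} :=
    fun p => ⟨p.2.2.1, p.2.2.2.1, hiff p.1 p.2.1 p.2.2.1 p.2.2.2.2⟩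
  have hφ : Function.Bijective φ := by
    constructor
    · rintro ⟨⟨μ, hμ⟩, ⟨S, hS⟩, v, hv, hv'⟩ ⟨⟨ν, hν⟩, ⟨T, hT⟩, w, hw, hw'⟩ h
      obtain rfl : v = w := congrArg Subtype.val h
      have hST : toTab S = toTab T := hv'.symm.trans hw'
      obtain rfl : μ = ν := by
        refine (shape_toTab S).symm.trans (Eq.trans ?_ (shape_toTab T))
        congr 1
      obtain rfl := toTab_injective hST
      rfl
    · rintro ⟨v, hv, hlen, hwt⟩
      obtain ⟨S, hS⟩ := (isTableau_tab v).exists_toTab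
      have h1 := sum_cells_of_tab_eq (fun _ => 1) hS.symm
      simp only [List.map_const', List.sum_replicate, smul_eq_mul, mul_one, Finset.sum_const] at h1
      have h2 : (isTableau_tab v).shape ∈ fattenedHooks n (k + 1 + 1) := by
        refine mem_fattenedHooks.2 ⟨h1.symm.trans hlen, fun h => ?_⟩
        exact (isTableau_tab v).mem_shape.1 h hv.tab_one_eq_top
      exact ⟨⟨⟨_, h2⟩, ⟨S, (sum_cells_of_tab_eq _ hS.symm).symm.trans hwt⟩, v, hv, hS.symm⟩, rfl⟩
  rw [← Nat.card_congr ((Equiv.sigmaCongrRight fun μ => Equiv.sigmaCongrRight fun T =>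
    (e1 μ T).some).trans (Equiv.ofBijective φ hφ))]
  have hfin := finite_tableaux (d := d)
  rw [Nat.card_sigma]
  refine Finset.sum_congr rfl fun μ _ => ?_
  rw [Nat.card_congr (Equiv.sigmaEquivProd _ _), Nat.card_prod, mul_comm, numSYT]

/-! ### From permutations to words -/

/-- Positions of the occurrence are indexed by pattern values instead of pattern positions: `g = e ∘
π⁻¹`. -/
theorem contains_iff {n m : ℕ} {σ : Equiv.Perm (Fin n)} {π : Equiv.Perm (Fin m)} :
    Contains σ π ↔ ∃ g : Fin m → Fin n, StrictMono (σ ∘ g) ∧ StrictMono (g ∘ π) := by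
  constructor
  · rintro ⟨e, he, h⟩
    refine ⟨e ∘ π.symm, fun a b hab => ?_, fun a b hab => by simpa using he hab⟩
    exact (h _ _).2 (by simpa using hab)
  · rintro ⟨g, h1, h2⟩
    exact ⟨g ∘ π, h2, fun a b => h1.lt_iff_lt⟩

theorem IsShuffle.eq_of_nil {α : Type*} {u v w : List α} (h : IsShuffle u v w) (hv : v = []) :
    w = u := by
  induction h with
  | nil => rfl
  | left x _ ih => rw [ih hv]
  | right x _ _ => cases hv

theorem IsShuffle.exists_append {α : Type*} {a : α} {u v w : List α} (h : IsShuffle u v w)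
    (hv : v = [a]) : ∃ u₁ u₂, u = u₁ ++ u₂ ∧ w = u₁ ++ a :: u₂ := by
  induction h with
  | nil => cases hv
  | left x _ ih =>
    obtain ⟨u₁, u₂, rfl, rfl⟩ := ih hv
    exact ⟨x :: u₁, u₂, rfl, rfl⟩
  | right x h _ =>
    obtain ⟨rfl, rfl⟩ := List.cons_eq_cons.1 hv
    exact ⟨[], _, rfl, by rw [h.eq_of_nil rfl, List.nil_append]⟩

theorem isShuffle_nil {α : Type*} (u : List α) : IsShuffle u [] u := by
  induction u with
  | nil => exact .nil
  | cons x u ih => exact .left x ih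

theorem isShuffle_append {α : Type*} (a : α) (u₁ u₂ : List α) :
    IsShuffle (u₁ ++ u₂) [a] (u₁ ++ a :: u₂) := by
  induction u₁ with
  | nil => exact .right a (isShuffle_nil _)
  | cons x u ih => exact .left x ih

theorem isShuffle_singleton_iff {α : Type*} [DecidableEq α] {a : α} {u w : List α} (hw : w.Nodup)
    (ha : a ∈ w) : IsShuffle u [a] w ↔ w.erase a = u := by
  constructor
  · intro h
    obtain ⟨u₁, u₂, rfl, rfl⟩ := h.exists_append rfl
    have : a ∉ u₁ := fun h => (List.nodup_append.1 hw).2.2 a h a (by simp) rfl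
    rw [List.erase_append_right _ this, List.erase_cons_head]
  · rintro rfl
    obtain ⟨u₁, u₂, h, rfl, h'⟩ := List.exists_erase_eq ha
    rw [h']
    exact isShuffle_append _ _ _

theorem eq_one_of_strictMono {N : ℕ} {π : Equiv.Perm (Fin N)} (h : StrictMono π) : π = 1 := by
  have := Subsingleton.elim (h.orderIsoOfSurjective π π.surjective) (OrderIso.refl _)
  exact Equiv.ext fun x => congrArg (fun e : Fin N ≃o Fin N => e x) this

theorem mem_partialShuffle {N : ℕ} {a : Fin N} {π : Equiv.Perm (Fin N)} :
    π ∈ partialShuffle a ↔ (∀ u v, u < v → π u ≠ a → π v ≠ a → π u < π v) ∧ π ≠ 1 := by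
  have hnd : (List.ofFn π).Nodup := List.nodup_ofFn.2 π.injective
  have ha : a ∈ List.ofFn π := by
    rw [List.mem_ofFn]
    exact π.surjective a
  have h1 : (∀ u v, u < v → π u ≠ a → π v ≠ a → π u < π v) ↔
      ((List.ofFn π).erase a).Pairwise (· < ·) := by
    rw [hnd.erase_eq_filter, List.pairwise_filter, List.pairwise_ofFn]
    simp
  have h2 : ((List.ofFn π).erase a).Perm ((List.finRange N).erase a) := by
    refine List.Perm.erase a ?_
    rw [List.perm_ext_iff_of_nodup hnd (List.nodup_finRange N)]
    intro b
    simp only [List.mem_ofFn, List.mem_finRange, iff_true]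
    exact π.surjective b
  have h3 : ((List.finRange N).erase a).Pairwise (· < ·) :=
    (List.pairwise_lt_finRange N).sublist List.erase_sublist
  have h4 : (List.ofFn π).erase a = (List.finRange N).erase a ↔
      ((List.ofFn π).erase a).Pairwise (· < ·) :=
    ⟨fun h => h ▸ h3, fun h => h2.eq_of_pairwise' (r := (· < ·)) h h3⟩
  rw [h1, ← h4, ← isShuffle_singleton_iff hnd ha]
  rfl

theorem exists_contains_partialShuffle_iff {n N : ℕ} {a : Fin N} {σ : Equiv.Perm (Fin n)} :
    (∃ π ∈ partialShuffle a, Contains σ π) ↔ ∃ g : Fin N → Fin n, StrictMono (σ ∘ g) ∧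
      (∀ u v, u < v → u ≠ a → v ≠ a → g u < g v) ∧ ¬ StrictMono g := by
  constructor
  · rintro ⟨π, hπ, h⟩
    obtain ⟨h1, h2⟩ := mem_partialShuffle.1 hπ
    obtain ⟨g, h3, h4⟩ := contains_iff.1 h
    refine ⟨g, h3, fun u v huv hu hv => ?_, fun hg => h2 (eq_one_of_strictMono fun x y hxy =>
      hg.lt_iff_lt.1 (h4 hxy))⟩
    obtain ⟨x, rfl⟩ := π.surjective u
    obtain ⟨y, rfl⟩ := π.surjective v
    rcases lt_trichotomy x y with hxy | rfl | hxy
    · exact h4 hxy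
    · exact (lt_irrefl _ huv).elim
    · exact ((h1 y x hxy hv hu).not_gt huv).elim
  · rintro ⟨g, h1, h2, h3⟩
    have hg : Function.Injective g := fun x y h => h1.injective (congrArg σ h)
    have h4 : StrictMono (g ∘ Tuple.sort g) :=
      (Tuple.monotone_sort g).strictMono_of_injective (hg.comp (Tuple.sort g).injective)
    -- The pattern formed by the positions `g` is the permutation sorting them.
    refine ⟨Tuple.sort g, mem_partialShuffle.2 ⟨fun u v huv hu hv => ?_, fun h => h3 ?_⟩,
      contains_iff.2 ⟨g, h1, h4⟩⟩
    · by_contra hlt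
      have hne := (Tuple.sort g).injective.ne huv.ne
      exact (h2 _ _ (lt_of_le_of_ne (not_lt.1 hlt) hne.symm) hv hu).not_gt (h4 huv)
    · rwa [h] at h4

/-- The inverse of the stable sort is the standardization, where equal letters increase from left to
right. -/
theorem sort_symm_lt_iff {n : ℕ} (w : Fin n → ℕ) {p q : Fin n} (hpq : p < q) :
    (Tuple.sort w).symm p < (Tuple.sort w).symm q ↔ w p ≤ w q := by
  obtain ⟨h1, h2⟩ := Tuple.eq_sort_iff.1 (rfl : Tuple.sort w = Tuple.sort w)
  obtain ⟨a, rfl⟩ := (Tuple.sort w).surjective p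
  obtain ⟨b, rfl⟩ := (Tuple.sort w).surjective q
  rw [Equiv.symm_apply_apply, Equiv.symm_apply_apply]
  refine ⟨fun h => h1 h.le, fun h => ?_⟩
  by_contra hab
  have hba := lt_of_le_of_ne (not_lt.1 hab) (by rintro rfl; exact lt_irrefl _ hpq)
  exact (h2 b a hba (le_antisymm (h1 hba.le) h)).not_gt hpq

theorem sort_mem_avoiders_iff {n N : ℕ} {a : Fin N} {w : Fin n → ℕ} :
    Tuple.sort w ∈ avoiders n (partialShuffle a) ↔ ∀ h : Fin N → Fin n, StrictMono h →
      (∀ u v, u < v → u ≠ a → v ≠ a → w (h u) ≤ w (h v)) → Monotone (w ∘ h) := by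
  have h1 : Tuple.sort w ∈ avoiders n (partialShuffle a) ↔
      ¬ ∃ π ∈ partialShuffle a, Contains (Tuple.sort w) π := by
    simp [avoiders]
  rw [h1, exists_contains_partialShuffle_iff]
  constructor
  · intro hno h hh h2
    by_contra hmono
    refine hno ⟨(Tuple.sort w).symm ∘ h, ?_, fun u v huv hu hv =>
      (sort_symm_lt_iff w (hh huv)).2 (h2 u v huv hu hv), fun hs => hmono ?_⟩
    · rw [← Function.comp_assoc, Equiv.self_comp_symm, Function.id_comp]
      exact hh
    · refine monotone_iff_forall_lt.2 fun u v huv => ?_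
      exact (sort_symm_lt_iff w (hh huv)).1 (hs huv)
  · rintro hall ⟨g, h2, h3, h4⟩
    refine h4 fun u v huv => ?_
    have key : ∀ u v, u < v → (g u < g v ↔ w (Tuple.sort w (g u)) ≤ w (Tuple.sort w (g v))) := by
      intro u v huv
      simpa using sort_symm_lt_iff w (h2 huv)
    refine (key u v huv).2 ?_
    exact hall _ h2 (fun u v huv hu hv => (key u v huv).1 (h3 u v huv hu hv)) huv.le

theorem sublist_reverse_ofFn_iff {n N : ℕ} {w : Fin n → ℕ} {L : List ℕ} :
    (L.Sublist (List.ofFn w).reverse ∧ L.length = N) ↔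
      ∃ h : Fin N → Fin n, StrictMono h ∧ L = (List.ofFn (w ∘ h)).reverse := by
  constructor
  · rintro ⟨h, rfl⟩
    rw [← List.reverse_sublist, List.reverse_reverse,
      List.sublist_iff_exists_fin_orderEmbedding_get_eq] at h
    obtain ⟨f, hf⟩ := h
    refine ⟨fun i => Fin.cast (by simp) (f (Fin.cast (by simp) i)), fun i j hij => ?_, ?_⟩
    · simpa using hij
    · rw [← List.reverse_inj, List.reverse_reverse]
      refine List.ext_get (by simp) fun i h1 h2 => ?_
      rw [hf ⟨i, h1⟩]
      simp
      rfl
  · rintro ⟨h, hh, rfl⟩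
    refine ⟨?_, by simp⟩
    rw [List.reverse_sublist, List.sublist_iff_exists_fin_orderEmbedding_get_eq]
    refine ⟨OrderEmbedding.ofStrictMono (fun i => Fin.cast (by simp) (h (Fin.cast (by simp) i)))
      fun i j hij => ?_, fun i => ?_⟩
    · simpa using hh (by simpa using hij)
    · simp
      rfl

theorem pairwise_reverse_ofFn_iff {N : ℕ} {s : Fin N → ℕ} :
    (List.ofFn s).reverse.Pairwise (· ≥ ·) ↔ Monotone s := by
  rw [List.pairwise_reverse, List.pairwise_ofFn, monotone_iff_forall_lt]

theorem reverse_ofFn_succ {N : ℕ} (s : Fin (N + 1) → ℕ) :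
    (List.ofFn s).reverse = s (Fin.last N) :: (List.ofFn fun i : Fin N => s i.castSucc).reverse := by
  rw [List.ofFn_succ', List.concat_eq_append, List.reverse_append]
  rfl

theorem goodTwo_iff {k n : ℕ} {w : Fin n → ℕ} :
    GoodTwo k (List.ofFn w).reverse ↔ Tuple.sort w ∈ avoiders n (patternSetTwo (k + 1)) := by
  rw [patternSetTwo, sort_mem_avoiders_iff]
  have key : ∀ s : Fin (k + 3) → ℕ,
      ((List.ofFn fun i : Fin (k + 2) => s i.castSucc).reverse.Pairwise (· ≥ ·) ↔
        ∀ u v, u < v → u ≠ ⟨k + 2, by omega⟩ → v ≠ ⟨k + 2, by omega⟩ → s u ≤ s v) := by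
    intro s
    rw [pairwise_reverse_ofFn_iff, monotone_iff_forall_lt]
    constructor
    · intro h u v huv hu hv
      rw [Ne, Fin.ext_iff] at hu hv
      dsimp only at hu hv
      exact @h ⟨u, by omega⟩ ⟨v, by omega⟩ huv
    · intro h u v huv
      refine h u.castSucc v.castSucc huv ?_ ?_ <;>
      · rw [Ne, Fin.ext_iff]
        simp only [Fin.val_castSucc]
        omega
  constructor
  · intro hg h hh hs
    rw [← pairwise_reverse_ofFn_iff, reverse_ofFn_succ]
    refine hg _ _ ?_ (by simp) ((key (w ∘ h)).2 hs)
    rw [← reverse_ofFn_succ]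
    exact (sublist_reverse_ofFn_iff.2 ⟨h, hh, rfl⟩).1
  · intro hall y l hl hlen hp
    obtain ⟨h, hh, he⟩ := sublist_reverse_ofFn_iff (N := k + 3).1 ⟨hl, by simp [hlen]⟩
    rw [he, pairwise_reverse_ofFn_iff]
    refine hall h hh ((key (w ∘ h)).1 ?_)
    rw [reverse_ofFn_succ, List.cons_eq_cons] at he
    exact he.2 ▸ hp

theorem goodOne_iff {k n : ℕ} {w : Fin n → ℕ} :
    GoodOne k (List.ofFn w).reverse ↔ Tuple.sort w ∈ avoiders n (patternSetOne (k + 1)) := by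
  rw [patternSetOne, sort_mem_avoiders_iff]
  have key : ∀ s : Fin (k + 3) → ℕ,
      ((s (Fin.last (k + 2)) :: (List.ofFn fun i : Fin (k + 1) => s i.castSucc.castSucc).reverse
        ).Pairwise (· ≥ ·) ↔
        ∀ u v, u < v → u ≠ ⟨k + 1, by omega⟩ → v ≠ ⟨k + 1, by omega⟩ → s u ≤ s v) := by
    intro s
    rw [List.pairwise_cons, pairwise_reverse_ofFn_iff, monotone_iff_forall_lt]
    simp only [List.mem_reverse, List.mem_ofFn, forall_exists_index, forall_apply_eq_imp_iff]
    constructor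
    · rintro ⟨h1, h2⟩ u v huv hu hv
      rw [Ne, Fin.ext_iff] at hu hv
      dsimp only at hu hv
      rcases Fin.eq_castSucc_or_eq_last v with ⟨v', rfl⟩ | rfl
      · rw [Fin.val_castSucc] at hv
        rw [Fin.lt_def, Fin.val_castSucc] at huv
        exact @h2 ⟨u, by omega⟩ ⟨v', by omega⟩ huv
      · rw [Fin.lt_def, Fin.val_last] at huv
        exact h1 ⟨u, by omega⟩
    · intro h
      refine ⟨fun i => h _ _ (Fin.castSucc_lt_last _) ?_ ?_, fun u v huv => h _ _ huv ?_ ?_⟩ <;>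
      · rw [Ne, Fin.ext_iff]
        simp only [Fin.val_castSucc, Fin.val_last]
        omega
  constructor
  · intro hg h hh hs
    rw [← pairwise_reverse_ofFn_iff, reverse_ofFn_succ, reverse_ofFn_succ]
    refine hg _ _ _ ?_ (by simp) ((key (w ∘ h)).2 hs)
    rw [← reverse_ofFn_succ (fun i : Fin (k + 2) => (w ∘ h) i.castSucc), ← reverse_ofFn_succ]
    exact (sublist_reverse_ofFn_iff.2 ⟨h, hh, rfl⟩).1
  · intro hall y x l hl hlen hp
    obtain ⟨h, hh, he⟩ := sublist_reverse_ofFn_iff (N := k + 3).1 ⟨hl, by simp [hlen]⟩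
    rw [he, pairwise_reverse_ofFn_iff]
    refine hall h hh ((key (w ∘ h)).1 ?_)
    rw [reverse_ofFn_succ, reverse_ofFn_succ, List.cons_eq_cons, List.cons_eq_cons] at he
    obtain ⟨rfl, -, rfl⟩ := he
    exact hp

/-! ### Coefficients of `Q` as numbers of words -/

theorem finite_fundamentalIndex (n : ℕ) (S : Set ℕ) (d : ℕ →₀ ℕ) :
    Finite {i : FundamentalIndex n S // ∑ j, Finsupp.single (i.1 j) 1 = d} := by
  have hd : ∀ (i : {i : FundamentalIndex n S // ∑ j, Finsupp.single (i.1 j) 1 = d}) (j : Fin n),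
      i.1.1 j ∈ d.support := by
    rintro ⟨i, hi⟩ j
    change i.1 j ∈ d.support
    rw [Finsupp.mem_support_iff, ← hi, Finsupp.finsetSum_apply]
    intro h0
    have := Finset.sum_eq_zero_iff.1 h0 j (Finset.mem_univ j)
    simp at this
  refine Finite.of_injective (β := Fin n → d.support) (fun i j => ⟨_, hd i j⟩) ?_
  intro i i' h
  exact Subtype.ext (Subtype.ext (funext fun j => congrArg Subtype.val (congrFun h j)))

/-- Strictness of `i` at the descents of `σ` is exactly stability: on a run of equal values of `i`
there is no descent, so `σ` increases there. -/
theorem sort_comp_symm {n : ℕ} (σ : Equiv.Perm (Fin n)) (i : FundamentalIndex n (descents σ)) :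
    Tuple.sort (i.1 ∘ σ.symm) = σ := by
  symm
  rw [Tuple.eq_sort_iff]
  have h0 : (i.1 ∘ σ.symm) ∘ σ = i.1 := by
    rw [Function.comp_assoc, Equiv.symm_comp_self, Function.comp_id]
  refine ⟨by rw [h0]; exact i.2.1, ?_⟩
  rintro a ⟨b, hb⟩ hab he
  simp only [Function.comp_apply, Equiv.symm_apply_apply] at he
  induction b with
  | zero => exact (Nat.not_lt_zero _ hab).elim
  | succ b ih =>
    have h1 : i.1 ⟨b, by omega⟩ ≤ i.1 ⟨b + 1, hb⟩ := i.2.1 (Nat.le_succ b)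
    have hab' : a ≤ ⟨b, by omega⟩ := Nat.le_of_lt_succ hab
    have h2 := i.2.1 hab'
    have h3 : σ ⟨b, by omega⟩ < σ ⟨b + 1, hb⟩ := by
      by_contra hlt
      have hne := σ.injective.ne (a₁ := ⟨b, by omega⟩) (a₂ := ⟨b + 1, hb⟩) (by simp)
      have := i.2.2 b hb ⟨hb, lt_of_le_of_ne (not_lt.1 hlt) hne.symm⟩
      omega
    rcases hab'.eq_or_lt with heq | hlt
    · rwa [heq]
    · exact (ih (by omega) hlt (by omega)).trans h3

theorem coeff_Q {n m : ℕ} (P : Set (Equiv.Perm (Fin m))) (d : ℕ →₀ ℕ) :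
    MvPowerSeries.coeff d (Q n P) = (Nat.card {w : Fin n → ℕ //
      Tuple.sort w ∈ avoiders n P ∧ ∑ j, Finsupp.single (w j) 1 = d} : ℝ) := by
  have h1 : MvPowerSeries.coeff d (Q n P) = ((∑ σ : avoiders n P, Nat.card
      {i : FundamentalIndex n (descents σ.1) // ∑ j, Finsupp.single (i.1 j) 1 = d} : ℕ) : ℝ) := by
    rw [Q, map_sum, Nat.cast_sum, ← Finset.sum_coe_sort]
    rfl
  have hfin := finite_fundamentalIndex n (d := d)
  rw [h1, ← Nat.card_sigma]
  have hsum : ∀ (σ : Equiv.Perm (Fin n)) (f : Fin n → ℕ),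
      ∑ j, Finsupp.single (f (σ j)) 1 = ∑ j, Finsupp.single (f j) 1 :=
    fun σ f => Equiv.sum_comp σ fun j => Finsupp.single (f j) 1
  congr 1
  refine Nat.card_congr (Equiv.ofBijective (fun p => ⟨p.2.1.1 ∘ p.1.1.symm, ?_, ?_⟩) ⟨?_, ?_⟩)
  · rw [sort_comp_symm]
    exact p.1.2
  · exact (hsum p.1.1.symm p.2.1.1).trans p.2.2
  · rintro ⟨⟨σ, hσ⟩, i, hi⟩ ⟨⟨τ, hτ⟩, j, hj⟩ h
    replace h : i.1 ∘ σ.symm = j.1 ∘ τ.symm := congrArg Subtype.val h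
    obtain rfl : σ = τ := by rw [← sort_comp_symm σ i, h, sort_comp_symm]
    obtain rfl : i = j := Subtype.ext (σ.symm.surjective.injective_comp_right h)
    rfl
  · rintro ⟨w, hw, hd⟩
    refine ⟨⟨⟨_, hw⟩, ⟨w ∘ Tuple.sort w, Tuple.monotone_sort w, ?_⟩, (hsum _ w).trans hd⟩, ?_⟩
    · rintro j hj ⟨_, hlt⟩
      refine lt_of_le_of_ne (Tuple.monotone_sort w (Nat.le_succ j)) fun h => ?_
      exact ((Tuple.eq_sort_iff.1 (rfl : Tuple.sort w = Tuple.sort w)).2 _ _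
        (Nat.lt_succ_self j) h).not_gt hlt
    · refine Subtype.ext ?_
      simp [Function.comp_assoc]

theorem coeff_Q_eq_card_list {n m : ℕ} {P : Set (Equiv.Perm (Fin m))} {p : List ℕ → Prop}
    (hp : ∀ w : Fin n → ℕ, p (List.ofFn w).reverse ↔ Tuple.sort w ∈ avoiders n P) (d : ℕ →₀ ℕ) :
    MvPowerSeries.coeff d (Q n P) =
      (Nat.card {v : List ℕ // p v ∧ v.length = n ∧ weight v = d} : ℝ) := by
  have hw : ∀ w : Fin n → ℕ, weight (List.ofFn w).reverse = ∑ j, Finsupp.single (w j) 1 := by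
    intro w
    rw [weight_perm (List.reverse_perm _), weight, List.map_ofFn, List.sum_ofFn]
    rfl
  rw [coeff_Q]
  congr 1
  refine Nat.card_congr (Equiv.ofBijective (fun w => ⟨(List.ofFn w.1).reverse, (hp _).2 w.2.1,
    by simp, (hw _).trans w.2.2⟩) ⟨fun w w' h => ?_, ?_⟩)
  · exact Subtype.ext (List.ofFn_injective (List.reverse_injective (congrArg Subtype.val h)))
  · rintro ⟨v, h1, rfl, h3⟩
    have h4 : (List.ofFn fun i : Fin v.length => v.reverse.get (i.cast (by simp))).reverse = v := by
      rw [List.reverse_eq_iff]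
      exact List.ext_get (by simp) fun i _ _ => by simp
    rw [← h4] at h1 h3
    exact ⟨⟨_, (hp _).1 h1, (hw _).symm.trans h3⟩, Subtype.ext h4⟩

end PatternQSym

theorem mainTheorem1 (k : ℕ) (hk : 1 ≤ k) (n : ℕ) :
    PatternQSym.Q n (PatternQSym.patternSetTwo k) =
        PatternQSym.Q n (PatternQSym.patternSetOne k) ∧
      PatternQSym.Q n (PatternQSym.patternSetOne k) =
        ∑ μ : PatternQSym.fattenedHooks n (k + 1),
          (PatternQSym.numSYT (PatternQSym.capFirstRow μ) : ℝ) • PatternQSym.schur μ.1 := by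
  -- The predicates on words are indexed by the theorem's parameter minus one.
  obtain ⟨k, rfl⟩ : ∃ l, k = l + 1 := ⟨k - 1, by omega⟩
  have h2 := fun d => PatternQSym.coeff_Q_eq_card_list (n := n)
    (fun w => PatternQSym.goodTwo_iff (k := k) (w := w)) d
  have h1 := fun d => PatternQSym.coeff_Q_eq_card_list (n := n)
    (fun w => PatternQSym.goodOne_iff (k := k) (w := w)) d
  have h12 : PatternQSym.Q n (PatternQSym.patternSetTwo (k + 1)) =
      PatternQSym.Q n (PatternQSym.patternSetOne (k + 1)) := by
    refine MvPowerSeries.ext fun d => ?_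
    rw [h1, h2]
    refine congrArg _ (Nat.card_congr (PatternQSym.goodEquiv k _ fun u v h => ?_))
    rw [h.length_eq, PatternQSym.weight_perm h]
  refine ⟨h12, ?_⟩
  rw [← h12]
  refine MvPowerSeries.ext fun d => ?_
  rw [h2, PatternQSym.card_goodTwo, map_sum, Nat.cast_sum]
  refine Finset.sum_congr rfl fun μ _ => ?_
  rw [Nat.cast_mul, MvPowerSeries.coeff_smul]
  rfl
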